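/- Let $d\ge 2$, $d/2<p\le\infty$, $\nu_d:=\frac{d-2}{2}$, and let $\mathbb{B}^d$ be the open unit ball of $\mathbb{R}^d$. Let $\gamma\in W^{2,p}(\mathbb{B}^d)$ be a radial conductivity, that is, a radial real-valued function, continuous on $\overline{\mathbb{B}^d}$, with $\gamma\ge c$ on $\mathbb{B}^d$ for some constant $c>0$. Put $$V:=\frac{\Delta\sqrt{\gamma}}{\sqrt{\gamma}}\quad\text{on }\mathbb{B}^d,\qquad V(x)=q_V(|x|)\ \text{a.e.},\qquad Q_V(t):=e^{-2t}q_V(e^{-t}),\quad t>0,$$ where $\Delta$ is the weak Laplacian. Let $H_{Q_V}=-\frac{d^2}{dt^2}+Q_V$ be the Schrödinger operator on $L^2(\mathbb{R}_+)$ with Dirichlet condition at $0$, with domain the set of $u\in L^2(\mathbb{R}_+)$ such that $u,u'$ are locally absolutely continuous on $[0,\infty)$, $-u''+Q_Vu\in L^2(\mathbb{R}_+)$ and $u(0)=0$. The discrete spectrum is the set of isolated points of the spectrum that are eigenvalues of finite multiplicity. $H_{Q_V}$ has a zero resonance if the solution $\psi$ of $-\psi''+Q_V\psi=0$ with $\psi(t)\to1$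 as $t\to\infty$ (the Jost solution at energy $0$) satisfies $\psi(0)=0$. Then: i) If $d>2$, the discrete spectrum of $H_{Q_V}$, and indeed the set of all its eigenvalues, is contained in $(-\nu_d^2,0)$. ii) If $d=2$, $H_{Q_V}$ has no eigenvalues, its discrete spectrum is empty, and it has no zero resonance. -/

import Mathlib

open MeasureTheory Set Filter Topology
open scoped ENNReal ContDiff

namespace RadialDtN

/-! ### Unbounded operators: spectrum, eigenspaces, discrete spectrum -/

section Operators

variable {H : Type*} [NormedAddCommGroup H] [NormedSpace ℂ H]

/-- `z` is in the resolvent set of the unbounded operator `T` if `T - z : D(T) → H` is a bijection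
with bounded inverse `R`. -/
def opResolventSet (T : H →ₗ.[ℂ] H) : Set ℂ :=
  {z | ∃ R : H →L[ℂ] H,
    (∀ f : H, ∃ h : R f ∈ T.domain, T ⟨R f, h⟩ - z • R f = f) ∧
    (∀ u : T.domain, R (T u - z • (u : H)) = u)}

/-- The spectrum of the unbounded operator `T`. -/
def opSpectrum (T : H →ₗ.[ℂ] H) : Set ℂ := (opResolventSet T)ᶜ

/-- The eigenspace `{u ∈ D(T) : T u = z u}`, written with the graph of `T`. -/
def eigenspace (T : H →ₗ.[ℂ] H) (z : ℂ) : Submodule ℂ H :=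
  T.graph.comap (LinearMap.prod LinearMap.id (z • LinearMap.id))

theorem mem_eigenspace_iff (T : H →ₗ.[ℂ] H) (z : ℂ) (u : H) :
    u ∈ eigenspace T z ↔ ∃ h : u ∈ T.domain, T ⟨u, h⟩ = z • u := by
  simp [eigenspace, LinearPMap.mem_graph_iff]

/-- The point spectrum: the set of all eigenvalues. -/
def opPointSpectrum (T : H →ₗ.[ℂ] H) : Set ℂ := {z | eigenspace T z ≠ ⊥}

/-- The discrete spectrum: the isolated points of the spectrum that are eigenvalues of finite
multiplicity. -/
def opDiscreteSpectrum (T : H →ₗ.[ℂ] H) : Set ℂ :=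
  {z | z ∈ opSpectrum T ∧ (∃ ε > 0, ∀ w ∈ opSpectrum T, dist w z < ε → w = z) ∧
    z ∈ opPointSpectrum T ∧ FiniteDimensional ℂ (eigenspace T z)}

end Operators

/-! ### The half-line Schrödinger operator with Dirichlet condition at `0` -/

/-- `v` and its derivative `v₁` are absolutely continuous on each `[0, R]`, and `w` is the
second derivative of `v` (almost everywhere). -/
def HasACSecondDeriv (v v₁ w : ℝ → ℂ) : Prop :=
  (∀ R > 0, AbsolutelyContinuousOnInterval v 0 R) ∧
  (∀ R > 0, AbsolutelyContinuousOnInterval v₁ 0 R) ∧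
  (∀ᵐ t ∂(volume.restrict (Ioi (0 : ℝ))), HasDerivAt v (v₁ t) t) ∧
  (∀ᵐ t ∂(volume.restrict (Ioi (0 : ℝ))), HasDerivAt v₁ (w t) t)

theorem HasACSecondDeriv.add {v v₁ w u u₁ y : ℝ → ℂ} (hv : HasACSecondDeriv v v₁ w)
    (hu : HasACSecondDeriv u u₁ y) : HasACSecondDeriv (v + u) (v₁ + u₁) (w + y) := by
  obtain ⟨a, b, c, d⟩ := hv
  obtain ⟨a', b', c', d'⟩ := hu
  refine ⟨fun R hR => (a R hR).add (a' R hR), fun R hR => (b R hR).add (b' R hR), ?_, ?_⟩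
  · filter_upwards [c, c'] with t h h' using h.add h'
  · filter_upwards [d, d'] with t h h' using h.add h'

theorem HasACSecondDeriv.smul {v v₁ w : ℝ → ℂ} (hv : HasACSecondDeriv v v₁ w) (k : ℂ) :
    HasACSecondDeriv (k • v) (k • v₁) (k • w) := by
  obtain ⟨a, b, c, d⟩ := hv
  refine ⟨fun R hR => (a R hR).const_smul k, fun R hR => (b R hR).const_smul k, ?_, ?_⟩
  · filter_upwards [c] with t h using h.const_smul k
  · filter_upwards [d] with t h using h.const_smul k

theorem HasACSecondDeriv.zero : HasACSecondDeriv 0 0 0 := by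
  have h : ∀ R > (0 : ℝ), AbsolutelyContinuousOnInterval (0 : ℝ → ℂ) 0 R := by
    intro R _
    simpa [AbsolutelyContinuousOnInterval] using tendsto_const_nhds
  refine ⟨h, h, ?_, ?_⟩ <;> exact Eventually.of_forall fun t => hasDerivAt_const t (0 : ℂ)

theorem continuousOn_Ioi_of_ac {v : ℝ → ℂ}
    (h : ∀ R > 0, AbsolutelyContinuousOnInterval v 0 R) : ContinuousOn v (Ioi 0) := by
  intro t ht
  have ht' : (0 : ℝ) < t := ht
  have h1 := (h (t + 1) (by linarith)).continuousOn
  rw [uIcc_of_le (by linarith)] at h1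
  exact (h1.continuousAt (Icc_mem_nhds ht' (by linarith))).continuousWithinAt

theorem HasACSecondDeriv.ae_zero {v v₁ w : ℝ → ℂ} (hv : HasACSecondDeriv v v₁ w)
    (h0 : v =ᵐ[volume.restrict (Ioi (0 : ℝ))] 0) :
    w =ᵐ[volume.restrict (Ioi (0 : ℝ))] 0 := by
  have key : ∀ f g : ℝ → ℂ, (∀ R > 0, AbsolutelyContinuousOnInterval f 0 R) →
      (∀ᵐ t ∂(volume.restrict (Ioi (0 : ℝ))), HasDerivAt f (g t) t) →
      f =ᵐ[volume.restrict (Ioi (0 : ℝ))] 0 → g =ᵐ[volume.restrict (Ioi (0 : ℝ))] 0 := by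
    intro f g hf hg h
    have e : EqOn f 0 (Ioi 0) :=
      Measure.eqOn_open_of_ae_eq h isOpen_Ioi (continuousOn_Ioi_of_ac hf) continuousOn_const
    filter_upwards [hg, ae_restrict_mem measurableSet_Ioi] with t ht hmem
    have hz : HasDerivAt f 0 t :=
      (hasDerivAt_const t (0 : ℂ)).congr_of_eventuallyEq
        (by filter_upwards [isOpen_Ioi.mem_nhds hmem] with s hs using e hs)
    exact ht.unique hz
  obtain ⟨a, b, c, d⟩ := hv
  exact key v₁ w b d (key v v₁ a c h0)

/-- The Hilbert space `L²(ℝ₊)` of complex-valued functions. -/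
abbrev HalfLineL2 : Type := Lp ℂ 2 (volume.restrict (Ioi (0 : ℝ)))

/-- The graph of the Dirichlet operator `-d²/dt² + Q` on `L²(ℝ₊)`: the pairs `(u, f)` in
`L² × L²` such that `u` has a representative `v` with `v, v'` locally absolutely continuous,
`v 0 = 0`, and `f = -v'' + Q v` almost everywhere. -/
def schrodingerGraph (Q : ℝ → ℝ) : Submodule ℂ (HalfLineL2 × HalfLineL2) where
  carrier := {x | ∃ v v₁ w : ℝ → ℂ, HasACSecondDeriv v v₁ w ∧ v 0 = 0 ∧
    x.1 =ᵐ[volume.restrict (Ioi (0 : ℝ))] v ∧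
    x.2 =ᵐ[volume.restrict (Ioi (0 : ℝ))] fun t => -w t + (Q t : ℂ) * v t}
  zero_mem' := by
    refine ⟨0, 0, 0, HasACSecondDeriv.zero, rfl, ?_, ?_⟩
    · exact Lp.coeFn_zero _ _ _
    · filter_upwards [Lp.coeFn_zero ℂ 2 (volume.restrict (Ioi (0 : ℝ)))] with t ht
      simpa using ht
  add_mem' := by
    rintro x y ⟨v, v₁, w, h, h0, hx, hx'⟩ ⟨u, u₁, z, g, g0, hy, hy'⟩
    refine ⟨_, _, _, h.add g, by simp [h0, g0], ?_, ?_⟩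
    · filter_upwards [Lp.coeFn_add x.1 y.1, hx, hy] with t a b c
      exact a.trans (by simp [b, c])
    · filter_upwards [Lp.coeFn_add x.2 y.2, hx', hy'] with t a b c
      refine a.trans ?_
      simp only [Pi.add_apply, b, c]
      ring
  smul_mem' := by
    rintro k x ⟨v, v₁, w, h, h0, hx, hx'⟩
    refine ⟨_, _, _, h.smul k, by simp [h0], ?_, ?_⟩
    · filter_upwards [Lp.coeFn_smul k x.1, hx] with t a b
      simp [a, b]
    · filter_upwards [Lp.coeFn_smul k x.2, hx'] with t a b
      simp [a, b]
      ring

theorem schrodingerGraph_snd_eq_zero (Q : ℝ → ℝ) (x : HalfLineL2 × HalfLineL2)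
    (hx : x ∈ schrodingerGraph Q) (h0 : x.1 = 0) : x.2 = 0 := by
  obtain ⟨v, v₁, w, h, -, hv, hf⟩ := hx
  have hv0 : v =ᵐ[volume.restrict (Ioi (0 : ℝ))] 0 := by
    rw [h0] at hv
    exact hv.symm.trans (Lp.coeFn_zero _ _ _)
  rw [Lp.eq_zero_iff_ae_eq_zero]
  filter_upwards [hf, hv0, h.ae_zero hv0] with t a b c
  simp [a, b, c]

/-- The Schrödinger operator `H_Q = -d²/dt² + Q` on `L²(ℝ₊)` with domain
`{u ∈ L² : u, u' ∈ AC_loc, H_Q u ∈ L², u(0) = 0}`. -/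
noncomputable def schrodingerOp (Q : ℝ → ℝ) : HalfLineL2 →ₗ.[ℂ] HalfLineL2 :=
  (schrodingerGraph Q).toLinearPMap

theorem schrodingerOp_graph (Q : ℝ → ℝ) : (schrodingerOp Q).graph = schrodingerGraph Q :=
  Submodule.toLinearPMap_graph_eq _ (schrodingerGraph_snd_eq_zero Q)

/-- `ψ` is a Jost solution at the parameter `z`: it solves `-ψ'' + Q ψ = -z² ψ` on `ℝ₊` and
`ψ(t) = e^{-tz} (1 + o(1))` as `t → ∞`. -/
def IsJostSolution (Q : ℝ → ℝ) (z : ℂ) (ψ : ℝ → ℂ) : Prop :=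
  (∃ ψ₁ w : ℝ → ℂ, HasACSecondDeriv ψ ψ₁ w ∧
    ∀ᵐ t ∂(volume.restrict (Ioi (0 : ℝ))), -w t + (Q t : ℂ) * ψ t = -z ^ 2 * ψ t) ∧
  Tendsto (fun t : ℝ => Complex.exp (t * z) * ψ t) atTop (𝓝 1)

/-- `H_Q` has a zero resonance if the Jost function `F(z) = ψ(0, z)` vanishes at `z = 0`. -/
def HasZeroResonance (Q : ℝ → ℝ) : Prop := ∃ ψ : ℝ → ℂ, IsJostSolution Q 0 ψ ∧ ψ 0 = 0

/-! ### Sobolev functions, conductivities and potentials on the unit ball -/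

/-- Smooth real functions with compact support contained in `U`. -/
def IsTestFunction {d : ℕ} (U : Set (EuclideanSpace ℝ (Fin d)))
    (φ : EuclideanSpace ℝ (Fin d) → ℝ) : Prop :=
  ContDiff ℝ ∞ φ ∧ HasCompactSupport φ ∧ tsupport φ ⊆ U

/-- `g` is the weak partial derivative `∂ᵢ u` on `U`. -/
def IsWeakPartialDeriv {d : ℕ} (U : Set (EuclideanSpace ℝ (Fin d))) (i : Fin d)
    (u g : EuclideanSpace ℝ (Fin d) → ℝ) : Prop :=
  LocallyIntegrableOn u U ∧ LocallyIntegrableOn g U ∧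
  ∀ φ, IsTestFunction U φ →
    ∫ x in U, u x * fderiv ℝ φ x (EuclideanSpace.single i 1) = -∫ x in U, g x * φ x

/-- `f` is the weak (distributional) Laplacian of `u` on `U`. -/
def IsWeakLaplacian {d : ℕ} (U : Set (EuclideanSpace ℝ (Fin d)))
    (u f : EuclideanSpace ℝ (Fin d) → ℝ) : Prop :=
  LocallyIntegrableOn u U ∧ LocallyIntegrableOn f U ∧
  ∀ φ, IsTestFunction U φ →
    ∫ x in U, u x * Laplacian.laplacian φ x = ∫ x in U, f x * φ x

/-- `u ∈ W^{2,p}(U)`: the function `u` and its weak partial derivatives of first and second order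
are in `L^p(U)`. -/
def MemW2p {d : ℕ} (U : Set (EuclideanSpace ℝ (Fin d))) (p : ℝ≥0∞)
    (u : EuclideanSpace ℝ (Fin d) → ℝ) : Prop :=
  MemLp u p (volume.restrict U) ∧
  ∃ (g : Fin d → EuclideanSpace ℝ (Fin d) → ℝ)
    (h : Fin d → Fin d → EuclideanSpace ℝ (Fin d) → ℝ),
    (∀ i, MemLp (g i) p (volume.restrict U) ∧ IsWeakPartialDeriv U i u (g i)) ∧
    (∀ i j, MemLp (h i j) p (volume.restrict U) ∧ IsWeakPartialDeriv U j (g i) (h i j))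

/-- The open unit ball of `ℝ^d`. -/
abbrev unitBall (d : ℕ) : Set (EuclideanSpace ℝ (Fin d)) := Metric.ball 0 1

/-- A conductivity on the unit ball: continuous on the closed ball and bounded below by a positive
constant. -/
def IsConductivity {d : ℕ} (γ : EuclideanSpace ℝ (Fin d) → ℝ) : Prop :=
  ContinuousOn γ (Metric.closedBall 0 1) ∧ ∃ c > 0, ∀ x ∈ unitBall d, c ≤ γ x

/-- `u` is radial on the unit ball. -/
def IsRadial {d : ℕ} (u : EuclideanSpace ℝ (Fin d) → ℝ) : Prop :=
  ∀ x ∈ unitBall d, ∀ y ∈ unitBall d, ‖x‖ = ‖y‖ → u x = u y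

/-- `V = Δ√γ / √γ` on the unit ball, i.e. `V √γ` is the weak Laplacian of `√γ`. -/
def IsPotentialOf {d : ℕ} (γ V : EuclideanSpace ℝ (Fin d) → ℝ) : Prop :=
  IsWeakLaplacian (unitBall d) (fun x => √(γ x)) (fun x => V x * √(γ x))

/-- `V = q(|·|)` almost everywhere on the unit ball. -/
def IsRadialProfile {d : ℕ} (V : EuclideanSpace ℝ (Fin d) → ℝ) (q : ℝ → ℝ) : Prop :=
  ∀ᵐ x ∂(volume.restrict (unitBall d)), V x = q ‖x‖

/-- The half-line potential `Q_V(t) = e^{-2t} q(e^{-t})` of the radial potential `V = q(|·|)`. -/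
noncomputable def halfLinePotential (q : ℝ → ℝ) (t : ℝ) : ℝ :=
  Real.exp (-2 * t) * q (Real.exp (-t))

/-- `ν_d = (d - 2) / 2`. -/
noncomputable def nu (d : ℕ) : ℝ := ((d : ℝ) - 2) / 2

end RadialDtN

open RadialDtN

namespace RadialDtN

/-! ### Weighted energy identity for `(φ² y')' = P y`. -/

open scoped ComplexConjugate

/-! The potential comes with an explicit positive solution. Put `W(t) = √γ` at radius `e^{-t}`. In
this variable `Δ√γ = V√γ` becomes `W'' - 2νW' = QW`, so `φ = e^{-νt} W` is positive and satisfies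
`-φ'' + Qφ = -ν²φ`.

Lower bound and reality. If `v` is an eigenfunction at `z` and `y = v/φ`, then `(φ² y')' = -(z + ν²)
φ² y`. Pairing with the conjugate of `y` gives `∫ φ²|y'|² = (z + ν²) ∫ φ²|y|²`, provided the flux
`φ² y' ȳ` vanishes at both ends. It does at `0` because `v 0 = 0`, and at infinity because `v` is
square integrable (`IsWeight.flux`). Hence `z` is real and `z > -ν²`, which is
`IsWeight.eq_zero_or_neg`.

Upper bound. Let `s = v/W` and let `m = W² s'` be the Wronskian of `v` and `W`. Then `m' = -(zW² +
2νWW') s`, where `W'` decays exponentially. For `z > 0` an almost conserved energy stays away from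
zero (`eq_zero_of_pos`). For `z = 0` a contraction argument from infinity forces `s = 0`
(`eq_zero_of_zero`). Both work with `s` and `m`, whose equations contain `W` and `W'` but not `Q`.

For `d = 2` one has `ν = 0`, so `(-ν², 0)` is empty. Moreover `W` itself solves the equation at
energy zero, so a second solution has constant Wronskian with it: it is a multiple of `W` or grows
linearly. Neither allows a Jost solution vanishing at `0`.

The analytic input is `exists_profile`. Testing the weak Laplacian with radial functions gives the
divergence theorem on balls, which makes `W` a `C¹` function with `W'` locally absolutely
continuous. Hölder's inequality for `Δγ ∈ L^p` gives `W' = O(e^{-δt})` with `δ = 2 - d/p`, positive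
exactly because `p > d/2`. -/

/-- A positive continuous bounded function on `(0, ∞)` which decreases at most by a constant factor
on intervals of length one. -/
structure IsWeight (φ : ℝ → ℝ) : Prop where
  pos : ∀ t > 0, 0 < φ t
  cont : ContinuousOn φ (Ioi 0)
  bdd : ∃ C, ∀ t > 0, φ t ≤ C
  slow : ∃ K > 0, ∀ t > 0, ∀ r, t < r → r ≤ t + 1 → φ t ≤ K * φ r

theorem not_integrableOn_Ioi_of_le {f : ℝ → ℝ} {a T κ : ℝ} (hκ : 0 < κ)
    (h : ∀ t > T, κ ≤ f t) : ¬ IntegrableOn f (Ioi a) := by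
  intro hf
  have h1 : IntegrableOn f (Ioi (max a T)) := hf.mono_set (Ioi_subset_Ioi (le_max_left _ _))
  have h2 : IntegrableOn (fun _ : ℝ => κ) (Ioi (max a T)) := by
    refine Integrable.mono' h1 aestronglyMeasurable_const ?_
    filter_upwards [ae_restrict_mem measurableSet_Ioi] with t ht
    rw [Real.norm_of_nonneg hκ.le]
    exact h t (lt_of_le_of_lt (le_max_right _ _) ht)
  rw [integrableOn_const_iff] at h2
  simp [hκ.ne'] at h2

/-- On `[t - 1, t]` the function `F` gains at least `2ε/φ(ξ)²` for some intermediate `ξ`, and `φ(ξ)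
≤ K φ(t)`; hence `φ² F` is eventually bounded below by `2ε/K²`. It is applied to `F = |y|²`, with
`R` the real part of the flux. -/
theorem IsWeight.not_integrableOn {φ F R : ℝ → ℝ} (hφ : IsWeight φ) {ε T : ℝ} (hε : 0 < ε)
    (hF : ∀ t > 0, HasDerivAt F (2 * R t / φ t ^ 2) t) (hF0 : ∀ t, 0 ≤ F t)
    (hR : ∀ t ≥ T, ε ≤ R t) : ¬ IntegrableOn (fun t => φ t ^ 2 * F t) (Ioi 1) := by
  obtain ⟨K, hK, hs⟩ := hφ.slow
  have hκ : 0 < 2 * ε / K ^ 2 := by positivity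
  refine not_integrableOn_Ioi_of_le (T := max 1 (T + 1)) hκ fun t ht => ?_
  have ht1 : 1 < t := lt_of_le_of_lt (le_max_left _ _) ht
  have htT : T + 1 < t := lt_of_le_of_lt (le_max_right _ _) ht
  obtain ⟨ξ, hξ, e⟩ := exists_hasDerivAt_eq_slope F (fun t => 2 * R t / φ t ^ 2)
    (show t - 1 < t by linarith)
    (fun x hx => (hF x (by linarith [hx.1])).continuousAt.continuousWithinAt)
    (fun x hx => hF x (by linarith [hx.1]))
  have hξ0 : 0 < ξ := by linarith [hξ.1]
  have h1 := hs ξ hξ0 t hξ.2 (by linarith [hξ.1])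
  have h2 := hR ξ (by linarith [hξ.1])
  have h3 := hφ.pos ξ hξ0
  have h4 : 2 * R ξ / φ ξ ^ 2 ≤ F t := by
    have := hF0 (t - 1)
    rw [show t - (t - 1) = 1 by ring, div_one] at e
    linarith
  have h5 : 0 < φ t := hφ.pos t (by linarith)
  have h6 : φ ξ ^ 2 ≤ K ^ 2 * φ t ^ 2 := by
    rw [← mul_pow]; gcongr
  calc 2 * ε / K ^ 2 = φ t ^ 2 * (2 * ε / (K ^ 2 * φ t ^ 2)) := by field_simp
    _ ≤ φ t ^ 2 * (2 * R ξ / φ ξ ^ 2) := by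
        have : 0 ≤ 2 * R ξ := by linarith
        gcongr
    _ ≤ _ := by gcongr

theorem hasDerivAt_mul_conj {n y : ℝ → ℂ} {n' y' : ℂ} {t : ℝ} (hn : HasDerivAt n n' t)
    (hy : HasDerivAt y y' t) :
    HasDerivAt (fun t => n t * conj (y t)) (n' * conj (y t) + n t * conj y') t := by
  exact hn.mul hy.star

theorem hasDerivAt_re {g : ℝ → ℂ} {g' : ℂ} {t : ℝ} (hg : HasDerivAt g g' t) :
    HasDerivAt (fun t => (g t).re) g'.re t :=
  Complex.reCLM.hasFDerivAt.comp_hasDerivAt t hg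

theorem hasDerivAt_im {g : ℝ → ℂ} {g' : ℂ} {t : ℝ} (hg : HasDerivAt g g' t) :
    HasDerivAt (fun t => (g t).im) g'.im t :=
  Complex.imCLM.hasFDerivAt.comp_hasDerivAt t hg

theorem hasDerivAt_norm_sq {y : ℝ → ℂ} {y' : ℂ} {t : ℝ} (hy : HasDerivAt y y' t) :
    HasDerivAt (fun t => ‖y t‖ ^ 2) (2 * (y' * conj (y t)).re) t := by
  convert hy.norm_sq using 1
  simp [Complex.inner]

/-- The derivative of `n ȳ` along solutions of `y' = n / φ²`, `n' = P y`. -/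
theorem hasDerivAt_energyFlux {φ : ℝ → ℝ} {y n P : ℝ → ℂ} {t : ℝ}
    (hy : HasDerivAt y (n t / (φ t : ℂ) ^ 2) t) (hn : HasDerivAt n (P t * y t) t) :
    HasDerivAt (fun t => n t * conj (y t))
      (P t * (‖y t‖ ^ 2 : ℝ) + (‖n t‖ ^ 2 / φ t ^ 2 : ℝ)) t := by
  convert hasDerivAt_mul_conj hn hy using 1
  rw [mul_assoc, Complex.mul_conj']
  simp only [map_div₀, map_pow, Complex.conj_ofReal]
  rw [← mul_div_assoc, Complex.mul_conj']
  push_cast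
  ring

/-- Here `n = φ² y'`. Square integrability of `y` with weight `φ²` controls the `P` term of the flux
derivative. The remaining term `|n|²/φ²` is nonnegative, so an upper bound for the flux along one
sequence suffices to integrate it. -/
theorem IsWeight.flux {φ : ℝ → ℝ} (hφ : IsWeight φ) {y n P : ℝ → ℂ} {K : ℝ}
    (hy : ∀ t > 0, HasDerivAt y (n t / (φ t : ℂ) ^ 2) t)
    (hn : ∀ t > 0, HasDerivAt n (P t * y t) t)
    (hP : ∀ t > 0, ‖P t‖ ≤ K * φ t ^ 2) (hPc : ContinuousOn P (Ioi 0))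
    (hint : IntegrableOn (fun t => φ t ^ 2 * ‖y t‖ ^ 2) (Ioi 1)) :
    IntegrableOn (fun t => ‖n t‖ ^ 2 / φ t ^ 2) (Ioi 1) ∧
      Tendsto (fun t => n t * conj (y t)) atTop (𝓝 0) := by
  have hyc : ContinuousOn y (Ioi 0) := fun t ht => (hy t ht).continuousAt.continuousWithinAt
  have hnc : ContinuousOn n (Ioi 0) := fun t ht => (hn t ht).continuousAt.continuousWithinAt
  have hφ0 : ∀ t ∈ Ioi (0 : ℝ), φ t ^ 2 ≠ 0 := fun t ht => (pow_pos (hφ.pos t ht) 2).ne'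
  have hqc : ContinuousOn (fun t => ‖n t‖ ^ 2 / φ t ^ 2) (Ioi 0) :=
    (hnc.norm.pow 2).div (hφ.cont.pow 2) hφ0
  have hpc : ContinuousOn (fun t => P t * ((‖y t‖ ^ 2 : ℝ) : ℂ)) (Ioi 0) :=
    hPc.mul (Complex.continuous_ofReal.comp_continuousOn (hyc.norm.pow 2))
  have hg := fun t (ht : t > 0) => hasDerivAt_energyFlux (hy t ht) (hn t ht)
  have hsub : Ioi (1 : ℝ) ⊆ Ioi 0 := Ioi_subset_Ioi zero_le_one
  have hpint : IntegrableOn (fun t => P t * ((‖y t‖ ^ 2 : ℝ) : ℂ)) (Ioi 1) := by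
    refine Integrable.mono' (hint.const_mul K)
      ((hpc.mono hsub).aestronglyMeasurable measurableSet_Ioi) ?_
    filter_upwards [ae_restrict_mem measurableSet_Ioi] with t ht
    rw [norm_mul, Complex.norm_real, norm_pow, norm_norm, ← mul_assoc]
    gcongr
    exact hP t (hsub ht)
  -- If the real part of the flux stayed at least `1`, then `|y|²` would grow too fast for `φ²|y|²`
  -- to be integrable.
  have hfreq : ∀ k : ℕ, ∃ b : ℝ, (k : ℝ) + 1 ≤ b ∧ (n b * conj (y b)).re < 1 := by
    intro k
    by_contra! hcon
    refine hφ.not_integrableOn (F := fun t => ‖y t‖ ^ 2) (R := fun t => (n t * conj (y t)).re)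
      one_pos (fun t ht => ?_) (fun t => by positivity) hcon hint
    convert hasDerivAt_norm_sq (hy t ht) using 1
    rw [← Complex.ofReal_pow, div_mul_eq_mul_div, Complex.div_ofReal_re]
    ring
  choose b hb1 hb2 using hfreq
  have hbt : Tendsto b atTop atTop :=
    tendsto_atTop_mono (fun k => by linarith [hb1 k]) tendsto_natCast_atTop_atTop
  have hq : IntegrableOn (fun t => ‖n t‖ ^ 2 / φ t ^ 2) (Ioi 1) := by
    refine integrableOn_Ioi_of_intervalIntegral_norm_bounded
      (1 - (n 1 * conj (y 1)).re + ∫ t in Ioi 1, ‖P t * ((‖y t‖ ^ 2 : ℝ) : ℂ)‖) 1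
      (l := atTop) (b := b) (fun k => ?_) hbt (Eventually.of_forall fun k => ?_)
    · refine (ContinuousOn.integrableOn_Icc (hqc.mono ?_)).mono_set Ioc_subset_Icc_self
      exact fun t ht => lt_of_lt_of_le one_pos ht.1
    · have hb : 1 ≤ b k := by have := hb1 k; have : (0 : ℝ) ≤ k := k.cast_nonneg; linarith
      have hss : uIcc 1 (b k) ⊆ Ioi 0 := by
        rw [uIcc_of_le hb]; exact fun t ht => lt_of_lt_of_le one_pos ht.1
      have hi1 : IntervalIntegrable (fun t => (P t * ((‖y t‖ ^ 2 : ℝ) : ℂ)).re) volume 1 (b k) :=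
        (Complex.continuous_re.comp_continuousOn (hpc.mono hss)).intervalIntegrable
      have hi2 : IntervalIntegrable (fun t => ‖n t‖ ^ 2 / φ t ^ 2) volume 1 (b k) :=
        (hqc.mono hss).intervalIntegrable
      have e := intervalIntegral.integral_eq_sub_of_hasDerivAt
        (fun t ht => hasDerivAt_re (hg t (hss ht))) (by simpa only [Complex.add_re, Complex.ofReal_re] using hi1.add hi2)
      simp only [Complex.add_re, Complex.ofReal_re] at e
      rw [intervalIntegral.integral_add hi1 hi2] at e
      have e2 : ∫ t in (1 : ℝ)..b k, ‖‖n t‖ ^ 2 / φ t ^ 2‖ =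
          ∫ t in (1 : ℝ)..b k, ‖n t‖ ^ 2 / φ t ^ 2 := by
        congr 1; ext t; exact Real.norm_of_nonneg (by positivity)
      have e3 : -∫ t in (1 : ℝ)..b k, (P t * ((‖y t‖ ^ 2 : ℝ) : ℂ)).re ≤
          ∫ t in Ioi 1, ‖P t * ((‖y t‖ ^ 2 : ℝ) : ℂ)‖ := by
        rw [← intervalIntegral.integral_neg, intervalIntegral.integral_of_le hb]
        have hii : IntegrableOn (fun t => ‖P t * ((‖y t‖ ^ 2 : ℝ) : ℂ)‖) (Ioc 1 (b k)) :=
          hpint.norm.mono_measure (Measure.restrict_mono Ioc_subset_Ioi_self le_rfl)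
        calc _ ≤ ∫ t in Ioc 1 (b k), ‖P t * ((‖y t‖ ^ 2 : ℝ) : ℂ)‖ := by
              refine setIntegral_mono_on ?_ hii measurableSet_Ioc fun t _ =>
                (neg_le_abs _).trans (Complex.abs_re_le_norm _)
              exact ((intervalIntegrable_iff_integrableOn_Ioc_of_le hb).1 hi1).neg
          _ ≤ _ := setIntegral_mono_set hpint.norm (Eventually.of_forall fun t => norm_nonneg _)
                (LE.le.eventuallyLE Ioc_subset_Ioi_self)
      rw [e2]
      have := hb2 k
      linarith
  refine ⟨hq, ?_⟩
  -- The flux is integrable by the inequality between geometric and arithmetic means applied to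
  -- `|n|/φ` and `φ|y|`, and so is its derivative; such a function tends to zero.
  refine tendsto_zero_of_hasDerivAt_of_integrableOn_Ioi (a := 1)
    (fun t ht => hg t (hsub ht)) (hpint.add hq.ofReal) ?_
  refine Integrable.mono' (hint.add hq)
    (((hnc.mul (Complex.continuous_conj.comp_continuousOn hyc)).mono hsub).aestronglyMeasurable
      measurableSet_Ioi) ?_
  filter_upwards [ae_restrict_mem measurableSet_Ioi] with t ht
  have hp := hφ.pos t (hsub ht)
  simp only [norm_mul, RCLike.norm_conj, Pi.add_apply]
  have e : ‖n t‖ * ‖y t‖ = (‖n t‖ / φ t) * (φ t * ‖y t‖) := by field_simp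
  rw [e, ← div_pow, ← mul_pow]
  nlinarith [sq_nonneg (‖n t‖ / φ t - φ t * ‖y t‖), sq_nonneg (‖n t‖ / φ t),
    sq_nonneg (φ t * ‖y t‖)]

/-- A monotone function with limit zero at both ends is identically zero. -/
theorem eq_zero_of_hasDerivAt_nonneg {R R' : ℝ → ℝ} (hR : ∀ t > 0, HasDerivAt R (R' t) t)
    (h0 : Tendsto R (𝓝[>] 0) (𝓝 0)) (hinf : Tendsto R atTop (𝓝 0))
    (hnn : ∀ t > 0, 0 ≤ R' t) : ∀ t > 0, R' t = 0 := by
  have hmono : MonotoneOn R (Ioi 0) := by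
    refine monotoneOn_of_deriv_nonneg (convex_Ioi 0)
      (fun t ht => (hR t ht).continuousAt.continuousWithinAt) ?_ ?_
    · rw [interior_Ioi]
      exact fun t ht => (hR t ht).differentiableAt.differentiableWithinAt
    · rw [interior_Ioi]
      exact fun t ht => by rw [(hR t ht).deriv]; exact hnn t ht
  have hz : ∀ t > 0, R t = 0 := by
    intro t ht
    refine le_antisymm ?_ ?_
    · refine ge_of_tendsto hinf ?_
      filter_upwards [eventually_ge_atTop t] with r hr
      exact hmono ht (lt_of_lt_of_le ht hr) hr
    · refine le_of_tendsto h0 ?_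
      filter_upwards [Ioo_mem_nhdsGT ht] with r hr
      exact hmono hr.1 ht hr.2.le
  intro t ht
  refine (hR t ht).unique ((hasDerivAt_const t (0 : ℝ)).congr_of_eventuallyEq ?_)
  filter_upwards [Ioi_mem_nhds ht] with r hr using hz r hr

theorem eq_of_hasDerivAt_zero {y : ℝ → ℂ} (hy : ∀ t > 0, HasDerivAt y 0 t) {a b : ℝ} (ha : 0 < a)
    (hb : 0 < b) : y a = y b := by
  have := (convex_Ioi (0 : ℝ)).norm_image_sub_le_of_norm_hasDerivWithin_le (C := 0)
    (fun t ht => (hy t ht).hasDerivWithinAt) (fun t _ => by simp) hb ha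
  simpa [sub_eq_zero] using this

theorem eq_zero_of_hasDerivAt_zero {y : ℝ → ℂ} (hy : ∀ t > 0, HasDerivAt y 0 t)
    (h0 : Tendsto y (𝓝[>] 0) (𝓝 0)) : ∀ t > 0, y t = 0 := by
  intro t ht
  refine tendsto_nhds_unique (Tendsto.congr' ?_ tendsto_const_nhds) h0
  filter_upwards [self_mem_nhdsWithin] with r hr using eq_of_hasDerivAt_zero hy ht hr

/-- A square integrable solution of `(φ² y')' = μ φ² y` vanishing at `0` is trivial, unless `μ` is
real and negative. -/
theorem IsWeight.eq_zero_or_neg {φ : ℝ → ℝ} (hφ : IsWeight φ) {y n : ℝ → ℂ} {μ : ℂ}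
    (hy : ∀ t > 0, HasDerivAt y (n t / (φ t : ℂ) ^ 2) t)
    (hn : ∀ t > 0, HasDerivAt n (μ * (φ t : ℂ) ^ 2 * y t) t)
    (h0 : Tendsto y (𝓝[>] 0) (𝓝 0))
    (hint : IntegrableOn (fun t => φ t ^ 2 * ‖y t‖ ^ 2) (Ioi 1)) :
    (∀ t > 0, y t = 0) ∨ (μ.im = 0 ∧ μ.re < 0) := by
  have hinf := (hφ.flux (K := ‖μ‖) hy hn (fun t _ => by simp)
    (continuousOn_const.mul ((Complex.continuous_ofReal.comp_continuousOn hφ.cont).pow 2)) hint).2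
  -- Near `0` both `φ` and `y` are bounded, hence so is `n'`; with `y → 0` this kills the flux at
  -- `0`.
  have hn0 : ∃ M, ∀ᶠ t in 𝓝[>] (0 : ℝ), ‖n t‖ ≤ M := by
    obtain ⟨C, hC⟩ := hφ.bdd
    have h1 : ∀ᶠ t in 𝓝[>] (0 : ℝ), ‖y t‖ ≤ 1 := by
      have := h0.norm.eventually (gt_mem_nhds (by simp : ‖(0 : ℂ)‖ < 1))
      filter_upwards [this] with t ht using ht.le
    obtain ⟨r, hr, hr1⟩ := (nhdsGT_basis (0 : ℝ)).eventually_iff.1 h1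
    have hr2 : r / 2 ∈ Ioo 0 r := ⟨by linarith, by linarith⟩
    refine ⟨‖μ‖ * C ^ 2 * r + ‖n (r / 2)‖, ?_⟩
    filter_upwards [Ioo_mem_nhdsGT hr] with t ht
    have := (convex_Ioo (0 : ℝ) r).norm_image_sub_le_of_norm_hasDerivWithin_le
      (C := ‖μ‖ * C ^ 2)
      (fun x hx => (hn x hx.1).hasDerivWithinAt) (fun x hx => ?_) hr2 ht
    · have h3 : ‖t - r / 2‖ ≤ r := by
        rw [Real.norm_eq_abs, abs_le]; constructor <;> linarith [ht.1, ht.2]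
      have h4 : ‖n t‖ ≤ ‖n t - n (r / 2)‖ + ‖n (r / 2)‖ := by
        simpa using norm_add_le (n t - n (r / 2)) (n (r / 2))
      have h5 : ‖μ‖ * C ^ 2 * ‖t - r / 2‖ ≤ ‖μ‖ * C ^ 2 * r := by gcongr
      linarith
    · have h6 := hr1 hx
      have h7 := hφ.pos x hx.1
      have h8 := hC x hx.1
      simp only [norm_mul, norm_pow, Complex.norm_real, Real.norm_of_nonneg h7.le]
      calc ‖μ‖ * φ x ^ 2 * ‖y x‖ ≤ ‖μ‖ * C ^ 2 * 1 := by gcongr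
        _ = _ := mul_one _
  have hg0 : Tendsto (fun t => n t * conj (y t)) (𝓝[>] 0) (𝓝 0) := by
    obtain ⟨M, hM⟩ := hn0
    refine squeeze_zero_norm' (a := fun t => M * ‖y t‖) ?_ (by simpa using h0.norm.const_mul M)
    filter_upwards [hM] with t ht
    rw [norm_mul, RCLike.norm_conj]
    gcongr
  have hg := fun t (ht : t > 0) =>
    hasDerivAt_energyFlux (P := fun t => μ * (φ t : ℂ) ^ 2) (hy t ht) (hn t ht)
  by_cases him : μ.im = 0
  · by_cases hre : μ.re < 0
    · exact Or.inr ⟨him, hre⟩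
    left
    push Not at hre
    have key := eq_zero_of_hasDerivAt_nonneg (fun t ht => hasDerivAt_re (hg t ht))
      ((Complex.continuous_re.tendsto 0).comp hg0) ((Complex.continuous_re.tendsto 0).comp hinf)
    have e : ∀ t, (μ * (φ t : ℂ) ^ 2 * ((‖y t‖ ^ 2 : ℝ) : ℂ) +
        ((‖n t‖ ^ 2 / φ t ^ 2 : ℝ) : ℂ)).re =
        μ.re * (φ t ^ 2 * ‖y t‖ ^ 2) + ‖n t‖ ^ 2 / φ t ^ 2 := by
      intro t
      rw [Complex.add_re, Complex.ofReal_re, mul_assoc, ← Complex.ofReal_pow, ← Complex.ofReal_mul,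
        Complex.re_mul_ofReal]
    simp only [e] at key
    have key2 := key fun t _ => by positivity
    refine eq_zero_of_hasDerivAt_zero (fun t ht => ?_) h0
    have hnz : n t = 0 := by
      have h1 := key2 t ht
      have h2 : 0 ≤ μ.re * (φ t ^ 2 * ‖y t‖ ^ 2) := by positivity
      have h3 : 0 ≤ ‖n t‖ ^ 2 / φ t ^ 2 := by positivity
      have h4 : ‖n t‖ ^ 2 / φ t ^ 2 = 0 := by linarith
      have h5 := hφ.pos t ht
      simpa [h5.ne'] using h4
    simpa [hnz] using hy t ht
  · left
    -- The extra factor `μ.im` makes the derivative `(Im μ)² φ²|y|²` nonnegative whatever the sign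
    -- of `Im μ`.
    have key := eq_zero_of_hasDerivAt_nonneg
      (fun t ht => (hasDerivAt_im (hg t ht)).const_mul μ.im)
      (by simpa only [Complex.zero_im, mul_zero, Function.comp_def] using
        ((Complex.continuous_im.tendsto 0).comp hg0).const_mul μ.im)
      (by simpa only [Complex.zero_im, mul_zero, Function.comp_def] using
        ((Complex.continuous_im.tendsto 0).comp hinf).const_mul μ.im)
    have e : ∀ t, μ.im * (μ * (φ t : ℂ) ^ 2 * ((‖y t‖ ^ 2 : ℝ) : ℂ) +
        ((‖n t‖ ^ 2 / φ t ^ 2 : ℝ) : ℂ)).im = μ.im ^ 2 * (φ t ^ 2 * ‖y t‖ ^ 2) := by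
      intro t
      rw [Complex.add_im, Complex.ofReal_im, mul_assoc, ← Complex.ofReal_pow, ← Complex.ofReal_mul,
        Complex.im_mul_ofReal]
      ring
    simp only [e] at key
    intro t ht
    have h1 := key (fun t _ => by positivity) t ht
    have h5 := hφ.pos t ht
    simpa [h5.ne', him] using h1

/-! ### Profiles with exponentially decaying derivative. -/

/-- A `C¹` function on `(0, ∞)`, bounded from above and away from zero, with exponentially decaying
derivative. -/
structure IsDecayingProfile (W W₁ : ℝ → ℝ) : Prop where
  lower : ∃ c > 0, ∀ t > 0, c ≤ W t
  upper : ∃ C, ∀ t > 0, W t ≤ C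
  hasDeriv : ∀ t > 0, HasDerivAt W (W₁ t) t
  cont : ContinuousOn W₁ (Ioi 0)
  decay : ∃ δ > 0, ∃ C, ∀ t > 0, |W₁ t| ≤ C * Real.exp (-δ * t)

namespace IsDecayingProfile

variable {W W₁ : ℝ → ℝ}

theorem pos (h : IsDecayingProfile W W₁) {t : ℝ} (ht : 0 < t) : 0 < W t := by
  obtain ⟨c, hc, hl⟩ := h.lower
  exact hc.trans_le (hl t ht)

theorem continuousOn (h : IsDecayingProfile W W₁) : ContinuousOn W (Ioi 0) :=
  fun t ht => (h.hasDeriv t ht).continuousAt.continuousWithinAt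

theorem isWeight (h : IsDecayingProfile W W₁) {ν : ℝ} (hν : 0 ≤ ν) :
    IsWeight (fun t => Real.exp (-ν * t) * W t) := by
  obtain ⟨c, hc, hl⟩ := h.lower
  obtain ⟨C, hu⟩ := h.upper
  have hC : 0 < C := hc.trans_le ((hl 1 one_pos).trans (hu 1 one_pos))
  refine ⟨fun t ht => mul_pos (Real.exp_pos _) (h.pos ht), ?_, ⟨C, fun t ht => ?_⟩,
    ⟨Real.exp ν * C / c, by positivity, fun t ht r htr hr => ?_⟩⟩
  · exact (Continuous.continuousOn (by fun_prop)).mul h.continuousOn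
  · have h1 : Real.exp (-ν * t) ≤ 1 := Real.exp_le_one_iff.2 (by nlinarith)
    calc Real.exp (-ν * t) * W t ≤ 1 * C :=
          mul_le_mul h1 (hu t ht) (h.pos ht).le zero_le_one
      _ = C := one_mul _
  · have h1 : Real.exp (-ν * t) ≤ Real.exp ν * Real.exp (-ν * r) := by
      rw [← Real.exp_add]; exact Real.exp_le_exp.2 (by nlinarith)
    have h2 : W t ≤ C / c * W r := by
      calc W t ≤ C := hu t ht
        _ = C / c * c := by field_simp
        _ ≤ _ := by gcongr; exact hl r (ht.trans htr)
    calc Real.exp (-ν * t) * W t ≤ (Real.exp ν * Real.exp (-ν * r)) * (C / c * W r) :=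
          mul_le_mul h1 h2 (h.pos ht).le (by positivity)
      _ = _ := by ring

theorem isWeight_self (h : IsDecayingProfile W W₁) : IsWeight W := by
  simpa using h.isWeight le_rfl

theorem exists_deriv_bound (h : IsDecayingProfile W W₁) : ∃ C ≥ 0, ∀ t > 0, |W₁ t| ≤ C := by
  obtain ⟨δ, hδ, C, hd⟩ := h.decay
  have hC : 0 ≤ C := by
    have := (abs_nonneg _).trans (hd 1 one_pos)
    exact nonneg_of_mul_nonneg_left this (Real.exp_pos _)
  refine ⟨C, hC, fun t ht => (hd t ht).trans ?_⟩
  exact mul_le_of_le_one_right hC (Real.exp_le_one_iff.2 (by nlinarith))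

/-- The coefficient in the equation `(W² s')' = -(κ W² + 2 ν W W') s`. -/
theorem coeff_bound (h : IsDecayingProfile W W₁) (κ ν : ℝ) :
    ∃ K ≥ 0, ∀ t > 0, ‖((-(κ * W t ^ 2 + 2 * ν * W t * W₁ t) : ℝ) : ℂ)‖ ≤ K * W t ^ 2 := by
  obtain ⟨c, hc, hl⟩ := h.lower
  obtain ⟨C, hC, hd⟩ := h.exists_deriv_bound
  refine ⟨|κ| + 2 * |ν| * C / c, by positivity, fun t ht => ?_⟩
  have hp := h.pos ht
  rw [Complex.norm_real, norm_neg, Real.norm_eq_abs]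
  calc |κ * W t ^ 2 + 2 * ν * W t * W₁ t| ≤ |κ| * W t ^ 2 + 2 * |ν| * W t * |W₁ t| := by
        refine (abs_add_le _ _).trans (le_of_eq ?_)
        simp only [abs_mul, abs_pow, abs_of_pos hp, abs_two]
    _ ≤ |κ| * W t ^ 2 + 2 * |ν| * W t * (C / c * W t) := by
        gcongr
        calc |W₁ t| ≤ C := hd t ht
          _ = C / c * c := by field_simp
          _ ≤ _ := by gcongr; exact hl t ht
    _ = _ := by ring

theorem coeff_cont (h : IsDecayingProfile W W₁) (κ ν : ℝ) :
    ContinuousOn (fun t => ((-(κ * W t ^ 2 + 2 * ν * W t * W₁ t) : ℝ) : ℂ)) (Ioi 0) := by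
  have h1 := h.continuousOn
  have h2 := h.cont
  exact Complex.continuous_ofReal.comp_continuousOn (by fun_prop)

variable {s m : ℝ → ℂ} {κ ν : ℝ}

/-- This is `IsWeight.flux` for the weight `W` itself; since `W` is bounded above and below,
weighted and unweighted integrability agree. -/
theorem flux_integrable (h : IsDecayingProfile W W₁)
    (hs : ∀ t > 0, HasDerivAt s (m t / (W t : ℂ) ^ 2) t)
    (hm : ∀ t > 0, HasDerivAt m (((-(κ * W t ^ 2 + 2 * ν * W t * W₁ t) : ℝ) : ℂ) * s t) t)
    (hint : IntegrableOn (fun t => ‖s t‖ ^ 2) (Ioi 1)) :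
    IntegrableOn (fun t => ‖m t‖ ^ 2) (Ioi 1) := by
  obtain ⟨C, hu⟩ := h.upper
  obtain ⟨K, hK, hb⟩ := h.coeff_bound κ ν
  have hsub : Ioi (1 : ℝ) ⊆ Ioi 0 := Ioi_subset_Ioi zero_le_one
  have hsc : ContinuousOn s (Ioi 0) := fun t ht => (hs t ht).continuousAt.continuousWithinAt
  have hmc : ContinuousOn m (Ioi 0) := fun t ht => (hm t ht).continuousAt.continuousWithinAt
  have h1 : IntegrableOn (fun t => W t ^ 2 * ‖s t‖ ^ 2) (Ioi 1) := by
    refine Integrable.mono' (hint.const_mul (C ^ 2))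
      ((((h.continuousOn.pow 2).mul (hsc.norm.pow 2)).mono hsub).aestronglyMeasurable
        measurableSet_Ioi) ?_
    filter_upwards [ae_restrict_mem measurableSet_Ioi] with t ht
    have hp := h.pos (hsub ht)
    rw [Real.norm_of_nonneg (by positivity)]
    gcongr
    exact hu t (hsub ht)
  have h2 := (h.isWeight_self.flux hs hm hb (h.coeff_cont κ ν) h1).1
  refine Integrable.mono' (h2.const_mul (C ^ 2))
    (((hmc.norm.pow 2).mono hsub).aestronglyMeasurable measurableSet_Ioi) ?_
  filter_upwards [ae_restrict_mem measurableSet_Ioi] with t ht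
  have hp := h.pos (hsub ht)
  rw [Real.norm_of_nonneg (by positivity)]
  calc ‖m t‖ ^ 2 = W t ^ 2 * (‖m t‖ ^ 2 / W t ^ 2) := by field_simp
    _ ≤ _ := by gcongr; exact hu t (hsub ht)

end IsDecayingProfile

/-! ### Absence of square integrable solutions at nonnegative energy. -/

theorem two_mul_re_mul_conj_le (a b : ℂ) : |2 * (a * conj b).re| ≤ ‖a‖ ^ 2 + ‖b‖ ^ 2 := by
  have h1 := Complex.abs_re_le_norm (a * conj b)
  rw [norm_mul, RCLike.norm_conj] at h1
  rw [abs_mul, abs_two]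
  nlinarith [sq_nonneg (‖a‖ - ‖b‖)]

theorem tendsto_zero_of_sq_integrable {f f' : ℝ → ℂ} (hf : ∀ t > 0, HasDerivAt f (f' t) t)
    (hc : ContinuousOn f' (Ioi 0)) (h1 : IntegrableOn (fun t => ‖f t‖ ^ 2) (Ioi 1))
    (h2 : IntegrableOn (fun t => ‖f' t‖ ^ 2) (Ioi 1)) : Tendsto f atTop (𝓝 0) := by
  have hsub : Ioi (1 : ℝ) ⊆ Ioi 0 := Ioi_subset_Ioi zero_le_one
  have hfc : ContinuousOn f (Ioi 0) := fun t ht => (hf t ht).continuousAt.continuousWithinAt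
  have h3 : Tendsto (fun t => ‖f t‖ ^ 2) atTop (𝓝 0) := by
    refine tendsto_zero_of_hasDerivAt_of_integrableOn_Ioi (a := 1)
      (fun t ht => hasDerivAt_norm_sq (hf t (hsub ht))) ?_ h1
    refine Integrable.mono' (h2.add h1) ?_ (Eventually.of_forall fun t => ?_)
    · refine ContinuousOn.aestronglyMeasurable ?_ measurableSet_Ioi
      refine ContinuousOn.mono ?_ hsub
      exact continuousOn_const.mul (Complex.continuous_re.comp_continuousOn
        (hc.mul (Complex.continuous_conj.comp_continuousOn hfc)))
    · exact two_mul_re_mul_conj_le _ _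
  rw [tendsto_zero_iff_norm_tendsto_zero]
  have := h3.sqrt
  simpa [Real.sqrt_sq] using this

theorem norm_le_of_deriv_exp_decay {f f' : ℝ → ℂ} {δ A T : ℝ} (hδ : 0 < δ) (hT : 0 < T)
    (hf : ∀ t > 0, HasDerivAt f (f' t) t) (hc : ContinuousOn f' (Ioi 0))
    (h0 : Tendsto f atTop (𝓝 0)) (hb : ∀ t ≥ T, ‖f' t‖ ≤ A * Real.exp (-δ * t)) :
    ∀ t ≥ T, ‖f t‖ ≤ A / δ * Real.exp (-δ * t) := by
  intro t ht
  have ht0 : 0 < t := hT.trans_le ht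
  have hi : IntegrableOn (fun r => A * Real.exp (-δ * r)) (Ioi t) :=
    (integrableOn_exp_mul_Ioi (neg_lt_zero.2 hδ) t).const_mul A
  have hle : ∀ᵐ r ∂(volume.restrict (Ioi t)), ‖f' r‖ ≤ A * Real.exp (-δ * r) := by
    filter_upwards [ae_restrict_mem measurableSet_Ioi] with r hr
    exact hb r (ht.le.trans (le_of_lt hr))
  have hi' : IntegrableOn f' (Ioi t) := by
    refine Integrable.mono' hi ?_ hle
    exact (hc.mono (Ioi_subset_Ioi ht0.le)).aestronglyMeasurable measurableSet_Ioi
  have e := integral_Ioi_of_hasDerivAt_of_tendsto' (fun r hr => hf r (ht0.trans_le hr)) hi' h0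
  have h1 := norm_integral_le_of_norm_le hi hle
  rw [e, zero_sub, norm_neg, integral_const_mul, integral_exp_mul_Ioi (neg_lt_zero.2 hδ)] at h1
  refine h1.trans (le_of_eq ?_)
  field_simp

namespace IsDecayingProfile

variable {W W₁ : ℝ → ℝ} {s m : ℝ → ℂ} {κ ν : ℝ}

theorem solution_cont (h : IsDecayingProfile W W₁)
    (hs : ∀ t > 0, HasDerivAt s (m t / (W t : ℂ) ^ 2) t)
    (hm : ∀ t > 0, HasDerivAt m (((-(κ * W t ^ 2 + 2 * ν * W t * W₁ t) : ℝ) : ℂ) * s t) t) :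
    ContinuousOn s (Ioi 0) ∧ ContinuousOn m (Ioi 0) ∧
      ContinuousOn (fun t => m t / (W t : ℂ) ^ 2) (Ioi 0) ∧
      ContinuousOn (fun t => ((-(κ * W t ^ 2 + 2 * ν * W t * W₁ t) : ℝ) : ℂ) * s t) (Ioi 0) := by
  have hsc : ContinuousOn s (Ioi 0) := fun t ht => (hs t ht).continuousAt.continuousWithinAt
  have hmc : ContinuousOn m (Ioi 0) := fun t ht => (hm t ht).continuousAt.continuousWithinAt
  refine ⟨hsc, hmc, hmc.div ((Complex.continuous_ofReal.comp_continuousOn h.continuousOn).pow 2)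
    fun t ht => ?_, (h.coeff_cont κ ν).mul hsc⟩
  simpa using (h.pos ht).ne'

/-- There is no nontrivial square integrable solution at positive energy. -/
theorem eq_zero_of_pos (h : IsDecayingProfile W W₁) (hκ : 0 < κ)
    (hs : ∀ t > 0, HasDerivAt s (m t / (W t : ℂ) ^ 2) t)
    (hm : ∀ t > 0, HasDerivAt m (((-(κ * W t ^ 2 + 2 * ν * W t * W₁ t) : ℝ) : ℂ) * s t) t)
    (hint : IntegrableOn (fun t => ‖s t‖ ^ 2) (Ioi 1)) : ∀ t > 0, s t = 0 := by
  obtain ⟨c, hc, hl⟩ := h.lower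
  obtain ⟨C, hu⟩ := h.upper
  obtain ⟨δ, hδ, B, hB⟩ := h.decay
  have hB0 : 0 ≤ B := by
    have := (abs_nonneg _).trans (hB 1 one_pos)
    exact nonneg_of_mul_nonneg_left this (Real.exp_pos _)
  have hsub : Ioi (1 : ℝ) ⊆ Ioi 0 := Ioi_subset_Ioi zero_le_one
  obtain ⟨hsc, hmc, -, -⟩ := h.solution_cont hs hm
  have hmint := h.flux_integrable hs hm hint
  -- The weight `κ W⁴` makes the two `2κW² Re(s m̄)` terms cancel, so every term left in `E'`
  -- carries the decaying factor `W₁`.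
  set E : ℝ → ℝ := fun t => ‖m t‖ ^ 2 + κ * W t ^ 4 * ‖s t‖ ^ 2 with hE
  set E' : ℝ → ℝ := fun t =>
    W₁ t * (-(4 * ν * W t * (s t * conj (m t)).re) + 4 * κ * W t ^ 3 * ‖s t‖ ^ 2) with hE'
  have hd : ∀ t > 0, HasDerivAt E (E' t) t := by
    intro t ht
    have hp := h.pos ht
    have e := (hasDerivAt_norm_sq (hm t ht)).add
      ((((h.hasDeriv t ht).pow 4).const_mul κ).mul (hasDerivAt_norm_sq (hs t ht)))
    refine e.congr_deriv ?_
    have e1 : (m t / (W t : ℂ) ^ 2 * conj (s t)).re = (s t * conj (m t)).re / W t ^ 2 := by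
      rw [div_mul_eq_mul_div, ← Complex.ofReal_pow, Complex.div_ofReal_re]
      congr 1
      simp
      ring
    rw [e1, mul_assoc, Complex.re_ofReal_mul, hE']
    simp only [Pi.pow_apply]
    field_simp
    push_cast
    ring
  -- The first summand bounds the cross term, by the arithmetic-geometric mean inequality for `√κ
  -- W²|s|` and `|m|`; the second bounds the term in `|s|²`.
  set D : ℝ := B * (2 * |ν| / (√κ * c) + 4 / c) with hD
  have hsκ : 0 < √κ := Real.sqrt_pos.2 hκ
  have hD0 : 0 ≤ D := by positivity
  have hbound : ∀ t > 0, -(D * Real.exp (-δ * t) * E t) ≤ E' t := by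
    intro t ht
    have hp := h.pos ht
    have hcW := hl t ht
    have hE0 : 0 ≤ E t := by positivity
    have h1 : |4 * ν * W t * (s t * conj (m t)).re| ≤ 2 * |ν| / (√κ * c) * E t := by
      have h2 := two_mul_re_mul_conj_le ((√κ * W t ^ 2 : ℝ) * s t) (m t)
      have h3 : ‖((√κ * W t ^ 2 : ℝ) : ℂ) * s t‖ ^ 2 + ‖m t‖ ^ 2 = E t := by
        rw [norm_mul, Complex.norm_real, Real.norm_of_nonneg (by positivity), mul_pow, mul_pow,
          Real.sq_sqrt hκ.le, hE]
        ring
      rw [h3, mul_assoc, Complex.re_ofReal_mul] at h2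
      have h4 : 4 * ν * W t * (s t * conj (m t)).re =
          (2 * ν / (√κ * W t)) * (2 * (√κ * W t ^ 2 * (s t * conj (m t)).re)) := by
        field_simp
        ring
      rw [h4, abs_mul]
      refine mul_le_mul ?_ h2 (abs_nonneg _) (by positivity)
      rw [abs_div, abs_mul, abs_two, abs_of_pos (by positivity : 0 < √κ * W t)]
      gcongr
    have h5 : |4 * κ * W t ^ 3 * ‖s t‖ ^ 2| ≤ 4 / c * E t := by
      rw [abs_of_nonneg (by positivity)]
      calc 4 * κ * W t ^ 3 * ‖s t‖ ^ 2 = 4 / W t * (κ * W t ^ 4 * ‖s t‖ ^ 2) := by field_simp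
        _ ≤ 4 / c * E t := by
          gcongr
          simp only [hE]
          nlinarith [sq_nonneg ‖m t‖]
    have h6 : |E' t| ≤ (B * Real.exp (-δ * t)) * (2 * |ν| / (√κ * c) * E t + 4 / c * E t) := by
      rw [hE', abs_mul]
      refine mul_le_mul (hB t ht) ?_ (abs_nonneg _) (by positivity)
      refine (abs_add_le _ _).trans ?_
      rw [abs_neg]
      exact add_le_add h1 h5
    have h7 := (abs_le.1 h6).1
    have h8 : D * Real.exp (-δ * t) * E t =
        (B * Real.exp (-δ * t)) * (2 * |ν| / (√κ * c) * E t + 4 / c * E t) := by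
      rw [hD]; ring
    rw [h8]; exact h7
  -- Integrating factor for `E' ≥ -D e^{-δt} E`. It is at most `1`, so monotonicity of the product
  -- bounds `E` below by a positive constant once `E` is nonzero somewhere.
  have hexp : ∀ t, HasDerivAt (fun t => Real.exp (-(D / δ) * Real.exp (-δ * t)))
      (Real.exp (-(D / δ) * Real.exp (-δ * t)) * (D * Real.exp (-δ * t))) t := by
    intro t
    have e := ((((hasDerivAt_id t).const_mul (-δ)).exp).const_mul (-(D / δ))).exp
    refine e.congr_deriv ?_
    simp only [id]
    field_simp
  have hmono : MonotoneOn (fun t => E t * Real.exp (-(D / δ) * Real.exp (-δ * t))) (Ioi 0) := by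
    have hdd := fun t (ht : t > 0) => (hd t ht).mul (hexp t)
    refine monotoneOn_of_deriv_nonneg (convex_Ioi 0)
      (fun t ht => (hdd t ht).continuousAt.continuousWithinAt) ?_ ?_
    · rw [interior_Ioi]
      exact fun t ht => (hdd t ht).differentiableAt.differentiableWithinAt
    · rw [interior_Ioi]
      intro t ht
      have := (hdd t ht).deriv
      have e2 : (fun t => E t * Real.exp (-(D / δ) * Real.exp (-δ * t))) =
        (E * fun t => Real.exp (-(D / δ) * Real.exp (-δ * t))) := rfl
      rw [e2, this]
      have h9 := hbound t ht
      have h10 := Real.exp_pos (-(D / δ) * Real.exp (-δ * t))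
      nlinarith
  intro t₀ ht₀
  by_contra hne
  have hp := h.pos ht₀
  have hs0 : 0 < ‖s t₀‖ := norm_pos_iff.2 hne
  have hE0 : 0 < E t₀ := by simp only [hE]; positivity
  refine not_integrableOn_Ioi_of_le (a := 1) (T := t₀)
    (κ := E t₀ * Real.exp (-(D / δ) * Real.exp (-δ * t₀))) (f := E) (by positivity) ?_ ?_
  · intro t ht
    refine (hmono ht₀ (ht₀.trans ht) ht.le).trans ?_
    have hEt : 0 ≤ E t := by positivity
    refine mul_le_of_le_one_right hEt (Real.exp_le_one_iff.2 ?_)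
    have : 0 ≤ D / δ * Real.exp (-δ * t) := by positivity
    linarith
  · refine hmint.add ?_
    refine Integrable.mono' (hint.const_mul (κ * C ^ 4)) (((ContinuousOn.mul
      (continuousOn_const.mul (h.continuousOn.pow 4)) (hsc.norm.pow 2)).mono
        hsub).aestronglyMeasurable measurableSet_Ioi) ?_
    filter_upwards [ae_restrict_mem measurableSet_Ioi] with t ht
    have hp := h.pos (hsub ht)
    rw [Real.norm_of_nonneg (by positivity)]
    gcongr
    exact hu t (hsub ht)

/-- A solution which vanishes far out vanishes everywhere. -/
theorem eq_zero_of_eventually_zero (h : IsDecayingProfile W W₁)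
    (hs : ∀ t > 0, HasDerivAt s (m t / (W t : ℂ) ^ 2) t)
    (hm : ∀ t > 0, HasDerivAt m (((-(κ * W t ^ 2 + 2 * ν * W t * W₁ t) : ℝ) : ℂ) * s t) t)
    {T : ℝ} (hT : 0 < T) (hz : ∀ t ≥ T, s t = 0) : ∀ t > 0, s t = 0 := by
  obtain ⟨c, hc, hl⟩ := h.lower
  obtain ⟨C, hu⟩ := h.upper
  obtain ⟨K, hK, hb⟩ := h.coeff_bound κ ν
  -- At `T + 1`, unlike at `T`, `s` vanishes on a two-sided neighbourhood, so its derivative is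
  -- known.
  have hmT : m (T + 1) = 0 := by
    have hT1 : 0 < T + 1 := by linarith
    have hp := h.pos hT1
    have e : m (T + 1) / (W (T + 1) : ℂ) ^ 2 = 0 := by
      refine (hs _ hT1).unique ((hasDerivAt_const (T + 1) (0 : ℂ)).congr_of_eventuallyEq ?_)
      filter_upwards [Ioi_mem_nhds (by linarith : T < T + 1)] with r hr using hz r (le_of_lt hr)
    simpa [hp.ne'] using e
  set E : ℝ → ℝ := fun t => ‖m t‖ ^ 2 + ‖s t‖ ^ 2 with hE
  -- Backward Grönwall constant: `K C²` comes from `m'` and `1/c²` from `s'`. As `E' ≥ -L E`, the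
  -- function `E e^{Lt}` increases up to its zero at `T + 1`.
  set L : ℝ := K * C ^ 2 + 1 / c ^ 2 with hL
  have hL0 : 0 ≤ L := by positivity
  have hd := fun t (ht : t > 0) => (hasDerivAt_norm_sq (hm t ht)).add (hasDerivAt_norm_sq (hs t ht))
  have hexp : ∀ t, HasDerivAt (fun t => Real.exp (L * t)) (Real.exp (L * t) * L) t := by
    intro t
    simpa using ((hasDerivAt_id t).const_mul L).exp
  have hmono : MonotoneOn (fun t => E t * Real.exp (L * t)) (Ioi 0) := by
    have hdd := fun t (ht : t > 0) => (hd t ht).mul (hexp t)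
    refine monotoneOn_of_deriv_nonneg (convex_Ioi 0)
      (fun t ht => (hdd t ht).continuousAt.continuousWithinAt) ?_ ?_
    · rw [interior_Ioi]
      exact fun t ht => (hdd t ht).differentiableAt.differentiableWithinAt
    · rw [interior_Ioi]
      intro t ht
      have hp := h.pos ht
      refine le_of_le_of_eq ?_ (hdd t ht).deriv.symm
      have h1 : |2 * (((-(κ * W t ^ 2 + 2 * ν * W t * W₁ t) : ℝ) : ℂ) * s t * conj (m t)).re| ≤
          K * C ^ 2 * E t := by
        rw [mul_assoc, Complex.re_ofReal_mul]
        have h2 := two_mul_re_mul_conj_le (s t) (m t)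
        have h3 := hb t ht
        rw [Complex.norm_real, Real.norm_eq_abs] at h3
        calc _ = |(-(κ * W t ^ 2 + 2 * ν * W t * W₁ t) : ℝ)| * |2 * (s t * conj (m t)).re| := by
              rw [← abs_mul]; congr 1; ring
          _ ≤ (K * C ^ 2) * (‖s t‖ ^ 2 + ‖m t‖ ^ 2) := by
              refine mul_le_mul (h3.trans ?_) h2 (abs_nonneg _) (by positivity)
              gcongr
              exact hu t ht
          _ = _ := by rw [hE]; ring
      have h4 : |2 * (m t / (W t : ℂ) ^ 2 * conj (s t)).re| ≤ 1 / c ^ 2 * E t := by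
        have h5 := two_mul_re_mul_conj_le (m t) (s t)
        rw [div_mul_eq_mul_div, ← Complex.ofReal_pow, Complex.div_ofReal_re, ← mul_div_assoc,
          abs_div, abs_of_pos (by positivity : 0 < W t ^ 2), one_div_mul_eq_div]
        have := hl t ht
        gcongr
      have h6 := (abs_le.1 h1).1
      have h7 := (abs_le.1 h4).1
      have h8 : (‖m t‖ ^ 2 + ‖s t‖ ^ 2) = E t := rfl
      simp only [Pi.add_apply]
      rw [h8, hL]
      have h10 := Real.exp_pos (L * t)
      rw [hL] at h10
      nlinarith
  intro t ht
  rcases le_or_gt T t with h1 | h1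
  · exact hz t h1
  have h2 := hmono (mem_Ioi.2 ht) (mem_Ioi.2 (by linarith : 0 < T + 1)) (by linarith)
  simp only [hE, hmT, hz (T + 1) (by linarith)] at h2
  have h3 := Real.exp_pos (L * t)
  have h4 : ‖m t‖ ^ 2 + ‖s t‖ ^ 2 ≤ 0 := by
    by_contra hcon
    push Not at hcon
    have := mul_pos hcon h3
    simp at h2
    linarith
  have h5 : ‖s t‖ ^ 2 ≤ 0 := by nlinarith [sq_nonneg ‖m t‖]
  simpa using le_antisymm h5 (sq_nonneg _)

/-- There is no nontrivial square integrable solution at zero energy. -/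
theorem eq_zero_of_zero (h : IsDecayingProfile W W₁)
    (hs : ∀ t > 0, HasDerivAt s (m t / (W t : ℂ) ^ 2) t)
    (hm : ∀ t > 0, HasDerivAt m (((-(0 * W t ^ 2 + 2 * ν * W t * W₁ t) : ℝ) : ℂ) * s t) t)
    (hint : IntegrableOn (fun t => ‖s t‖ ^ 2) (Ioi 1)) : ∀ t > 0, s t = 0 := by
  obtain ⟨c, hc, hl⟩ := h.lower
  obtain ⟨C, hu⟩ := h.upper
  obtain ⟨K, hK, hb⟩ := h.coeff_bound 0 ν
  obtain ⟨δ, hδ, B, hB⟩ := h.decay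
  have hC : 0 < C := hc.trans_le ((hl 1 one_pos).trans (hu 1 one_pos))
  have hB0 : 0 ≤ B := by
    have := (abs_nonneg _).trans (hB 1 one_pos)
    exact nonneg_of_mul_nonneg_left this (Real.exp_pos _)
  have hsub : Ioi (1 : ℝ) ⊆ Ioi 0 := Ioi_subset_Ioi zero_le_one
  obtain ⟨hsc, hmc, hsc', hmc'⟩ := h.solution_cont hs hm
  have hmint := h.flux_integrable hs hm hint
  have hs_bd : ∀ t > 0, ‖m t / (W t : ℂ) ^ 2‖ ≤ 1 / c ^ 2 * ‖m t‖ := by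
    intro t ht
    have hp := h.pos ht
    have := hl t ht
    rw [norm_div, norm_pow, Complex.norm_real, Real.norm_of_nonneg hp.le, one_div_mul_eq_div]
    gcongr
  have hs0 : Tendsto s atTop (𝓝 0) := by
    refine tendsto_zero_of_sq_integrable hs hsc' hint ?_
    refine Integrable.mono' (hmint.const_mul ((1 / c ^ 2) ^ 2))
      (((hsc'.norm.pow 2).mono hsub).aestronglyMeasurable measurableSet_Ioi) ?_
    filter_upwards [ae_restrict_mem measurableSet_Ioi] with t ht
    rw [Real.norm_of_nonneg (by positivity), ← mul_pow]
    gcongr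
    exact hs_bd t (hsub ht)
  have hm0 : Tendsto m atTop (𝓝 0) := by
    refine tendsto_zero_of_sq_integrable hm hmc' hmint ?_
    refine Integrable.mono' (hint.const_mul ((K * C ^ 2) ^ 2))
      (((hmc'.norm.pow 2).mono hsub).aestronglyMeasurable measurableSet_Ioi) ?_
    filter_upwards [ae_restrict_mem measurableSet_Ioi] with t ht
    rw [Real.norm_of_nonneg (by positivity), ← mul_pow, norm_mul]
    have hp := h.pos (hsub ht)
    gcongr
    refine (hb t (hsub ht)).trans ?_
    gcongr
    exact hu t (hsub ht)
  have hm_bd : ∀ t > 0, ∀ A, ‖s t‖ ≤ A →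
      ‖((-(0 * W t ^ 2 + 2 * ν * W t * W₁ t) : ℝ) : ℂ) * s t‖ ≤
        2 * |ν| * C * B * A * Real.exp (-δ * t) := by
    intro t ht A hA
    have hp := h.pos ht
    rw [norm_mul, Complex.norm_real, Real.norm_eq_abs, abs_neg, zero_mul, zero_add, abs_mul,
      abs_mul, abs_mul, abs_two, abs_of_pos hp]
    calc 2 * |ν| * W t * |W₁ t| * ‖s t‖ ≤ 2 * |ν| * C * (B * Real.exp (-δ * t)) * A := by
          gcongr
          · exact hu t ht
          · exact hB t ht
      _ = _ := by ring
  -- The constant is what two integrations from infinity, of `m'` and then of `s'`, produce from a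
  -- bound on `s`; beyond `T` it is at most `1/2`. Iterating `step` then gives `|s| ≤ 2^{-k}` for
  -- every `k`.
  obtain ⟨T, hT, hhalf, hsT⟩ : ∃ T > 0,
      1 / c ^ 2 * (2 * |ν| * C * B / δ) / δ * Real.exp (-δ * T) ≤ 1 / 2 ∧ ∀ t ≥ T, ‖s t‖ ≤ 1 := by
    have h1 : Tendsto (fun T => 1 / c ^ 2 * (2 * |ν| * C * B / δ) / δ * Real.exp (-δ * T)) atTop
        (𝓝 0) := by
      have : Tendsto (fun T : ℝ => Real.exp (-δ * T)) atTop (𝓝 0) :=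
        Real.tendsto_exp_atBot.comp ((tendsto_const_mul_atBot_of_neg (by linarith)).2 tendsto_id)
      simpa using this.const_mul _
    have h2 := h1.eventually (ge_mem_nhds (by norm_num : (0 : ℝ) < 1 / 2))
    have h3 := hs0.norm.eventually (ge_mem_nhds (by simp : ‖(0 : ℂ)‖ < 1))
    obtain ⟨T, hT⟩ := eventually_atTop.1 ((h2.and h3).and (eventually_gt_atTop 0))
    exact ⟨T, (hT T le_rfl).2, (hT T le_rfl).1.1, fun t ht => (hT t ht).1.2⟩
  have step : ∀ A, (∀ t ≥ T, ‖s t‖ ≤ A) → ∀ t ≥ T, ‖s t‖ ≤ A / 2 := by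
    intro A hA t ht
    have hA0 : 0 ≤ A := (norm_nonneg _).trans (hA T le_rfl)
    have h1 := norm_le_of_deriv_exp_decay (A := 2 * |ν| * C * B * A) hδ hT hm hmc' hm0
      (fun r hr => hm_bd r (hT.trans_le hr) A (hA r hr))
    have h2 := norm_le_of_deriv_exp_decay (A := 1 / c ^ 2 * (2 * |ν| * C * B * A / δ)) hδ hT hs
      hsc' hs0 (fun r hr => (hs_bd r (hT.trans_le hr)).trans (by
        rw [mul_assoc]; gcongr; exact h1 r hr)) t ht
    refine h2.trans ?_
    have h3 : Real.exp (-δ * t) ≤ Real.exp (-δ * T) := Real.exp_le_exp.2 (by nlinarith)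
    calc 1 / c ^ 2 * (2 * |ν| * C * B * A / δ) / δ * Real.exp (-δ * t)
        ≤ 1 / c ^ 2 * (2 * |ν| * C * B * A / δ) / δ * Real.exp (-δ * T) := by gcongr
      _ = A * (1 / c ^ 2 * (2 * |ν| * C * B / δ) / δ * Real.exp (-δ * T)) := by ring
      _ ≤ A * (1 / 2) := by gcongr
      _ = _ := by ring
  have hpow : ∀ k : ℕ, ∀ t ≥ T, ‖s t‖ ≤ (1 / 2) ^ k := by
    intro k
    induction k with
    | zero => simpa using hsT
    | succ k ih =>
      intro t ht
      refine (step _ ih t ht).trans (le_of_eq ?_)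
      rw [pow_succ]; ring
  refine h.eq_zero_of_eventually_zero hs hm hT fun t ht => ?_
  rw [← norm_le_zero_iff]
  exact ge_of_tendsto' (tendsto_pow_atTop_nhds_zero_of_lt_one (by norm_num) (by norm_num))
    fun k => hpow k t ht

end IsDecayingProfile

/-! ### Absolutely continuous solutions and their Wronskian with the profile. -/

theorem absolutelyContinuousOnInterval_of_hasDerivAt {F : Type*} [NormedAddCommGroup F]
    [NormedSpace ℝ F] {f f' : ℝ → F} (hf : ∀ t > 0, HasDerivAt f (f' t) t)
    (hc : ContinuousOn f' (Ioi 0)) {a b : ℝ} (ha : 0 < a) (hab : a ≤ b) :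
    AbsolutelyContinuousOnInterval f a b := by
  have hsub : Icc a b ⊆ Ioi 0 := fun t ht => ha.trans_le ht.1
  obtain ⟨C, hC⟩ := isCompact_Icc.exists_bound_of_continuousOn (hc.mono hsub)
  refine LipschitzOnWith.absolutelyContinuousOnInterval (K := C.toNNReal) ?_
  rw [uIcc_of_le hab]
  refine (convex_Icc a b).lipschitzOnWith_of_nnnorm_hasDerivWithin_le
    (fun t ht => (hf t (hsub ht)).hasDerivWithinAt) fun t ht => ?_
  rw [← NNReal.coe_le_coe, coe_nnnorm]
  exact (hC t ht).trans (Real.le_coe_toNNReal C)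

theorem hasDerivAt_integral_Ioi {g : ℝ → ℂ} (hg : ContinuousOn g (Ioi 0)) {a t : ℝ} (ha : 0 < a)
    (ht : 0 < t) : HasDerivAt (fun x => ∫ r in a..x, g r) (g t) t := by
  have hsub : uIcc a t ⊆ Ioi 0 := fun r hr => (lt_min ha ht).trans_le hr.1
  refine intervalIntegral.integral_hasDerivAt_right (hg.mono hsub).intervalIntegrable ?_
    (hg.continuousAt (Ioi_mem_nhds ht))
  exact hg.stronglyMeasurableAtFilter isOpen_Ioi t ht

/-- A locally absolutely continuous function whose derivative is a.e. equal to a continuous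
function is continuously differentiable. -/
theorem hasDerivAt_of_ae_hasDerivAt {f g : ℝ → ℂ} (hg : ContinuousOn g (Ioi 0))
    (hf : ∀ a b, 0 < a → a ≤ b → AbsolutelyContinuousOnInterval f a b)
    (h : ∀ᵐ t ∂(volume.restrict (Ioi (0 : ℝ))), HasDerivAt f (g t) t) :
    ∀ t > 0, HasDerivAt f (g t) t := by
  intro t ht
  have hG := fun x (hx : x > 0) => hasDerivAt_integral_Ioi hg ht hx
  have ha : 0 < t / 2 := by linarith
  have hac : AbsolutelyContinuousOnInterval (fun x => f x - ∫ r in t..x, g r) (t / 2) (t + 1) :=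
    (hf _ _ ha (by linarith)).sub
      (absolutelyContinuousOnInterval_of_hasDerivAt hG hg ha (by linarith))
  obtain ⟨c, hc⟩ := hac.const_of_ae_hasDerivAt_zero (by
    rw [ae_restrict_iff' measurableSet_Ioi] at h
    filter_upwards [h] with x hx hmem
    rw [uIcc_of_le (by linarith)] at hmem
    have hx0 : 0 < x := ha.trans_le hmem.1
    exact ((hx hx0).sub (hG x hx0)).congr_deriv (sub_self _))
  refine ((hG t ht).const_add c).congr_of_eventuallyEq ?_
  filter_upwards [Icc_mem_nhds (by linarith : t / 2 < t) (by linarith : t < t + 1)] with x hx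
  rw [← hc x (by rwa [uIcc_of_le (by linarith)])]
  ring

/-- The derivative `W₁` of the profile is locally absolutely continuous and
`W'' - 2 ν W' = Q W` almost everywhere. -/
structure SolvesProfileEq (Q W W₁ : ℝ → ℝ) (ν : ℝ) : Prop where
  ac : ∀ a b, 0 < a → a ≤ b → AbsolutelyContinuousOnInterval W₁ a b
  eq : ∀ᵐ t ∂(volume.restrict (Ioi (0 : ℝ))), HasDerivAt W₁ (2 * ν * W₁ t + Q t * W t) t

theorem HasACSecondDeriv.ac_left {v v₁ w : ℝ → ℂ} (h : HasACSecondDeriv v v₁ w) :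
    ∀ a b, 0 < a → a ≤ b → AbsolutelyContinuousOnInterval v a b := by
  intro a b ha hab
  refine (h.1 b (ha.trans_le hab)).mono ?_
  rw [uIcc_of_le hab, uIcc_of_le (ha.le.trans hab)]
  exact Icc_subset_Icc_left ha.le

theorem HasACSecondDeriv.ac_deriv {v v₁ w : ℝ → ℂ} (h : HasACSecondDeriv v v₁ w) :
    ∀ a b, 0 < a → a ≤ b → AbsolutelyContinuousOnInterval v₁ a b := by
  intro a b ha hab
  refine (h.2.1 b (ha.trans_le hab)).mono ?_
  rw [uIcc_of_le hab, uIcc_of_le (ha.le.trans hab)]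
  exact Icc_subset_Icc_left ha.le

theorem HasACSecondDeriv.hasDerivAt {v v₁ w : ℝ → ℂ} (h : HasACSecondDeriv v v₁ w) :
    ∀ t > 0, HasDerivAt v (v₁ t) t :=
  hasDerivAt_of_ae_hasDerivAt (continuousOn_Ioi_of_ac h.2.1) h.ac_left h.2.2.1

theorem HasACSecondDeriv.tendsto_zero {v v₁ w : ℝ → ℂ} (h : HasACSecondDeriv v v₁ w)
    (h0 : v 0 = 0) : Tendsto v (𝓝[>] 0) (𝓝 0) := by
  have h1 := (h.1 1 one_pos).continuousOn 0 (by simp)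
  rw [uIcc_of_le zero_le_one] at h1
  have h2 : Tendsto v (𝓝[Icc 0 1] 0) (𝓝 0) := by simpa [ContinuousWithinAt, h0] using h1
  refine h2.mono_left ?_
  rw [← nhdsWithin_Ioo_eq_nhdsGT (zero_lt_one' ℝ)]
  exact nhdsWithin_mono _ Ioo_subset_Icc_self

namespace IsDecayingProfile

variable {Q W W₁ : ℝ → ℝ} {ν : ℝ} {v v₁ w : ℝ → ℂ} {z : ℂ}

/-- The Wronskian of `v` and `W` is continuously differentiable. -/
theorem hasDerivAt_wronskian (h : IsDecayingProfile W W₁) (hW : SolvesProfileEq Q W W₁ ν)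
    (hv : HasACSecondDeriv v v₁ w)
    (he : ∀ᵐ t ∂(volume.restrict (Ioi (0 : ℝ))), -w t + (Q t : ℂ) * v t = z * v t) :
    ∀ t > 0, HasDerivAt (fun t => W t • v₁ t - W₁ t • v t)
      (-(z * W t + 2 * ν * W₁ t) * v t) t := by
  refine hasDerivAt_of_ae_hasDerivAt (g := fun t => -(z * W t + 2 * ν * W₁ t) * v t) ?_ ?_ ?_
  · have h1 := Complex.continuous_ofReal.comp_continuousOn h.continuousOn
    have h2 := Complex.continuous_ofReal.comp_continuousOn h.cont
    exact (((continuousOn_const.mul h1).add (continuousOn_const.mul h2)).neg).mul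
      (continuousOn_Ioi_of_ac hv.1)
  · intro a b ha hab
    exact ((absolutelyContinuousOnInterval_of_hasDerivAt h.hasDeriv h.cont ha hab).smul
      (hv.ac_deriv a b ha hab)).sub ((hW.ac a b ha hab).smul (hv.ac_left a b ha hab))
  · filter_upwards [he, hW.eq, hv.2.2.2, ae_restrict_mem measurableSet_Ioi] with t h1 h2 h3 ht
    refine (((h.hasDeriv t ht).smul h3).sub (h2.smul (hv.hasDerivAt t ht))).congr_deriv ?_
    -- The terms `Q W v` cancel. What remains is continuous, so the almost everywhere derivative of
    -- the Wronskian is its derivative everywhere, although `v₁` and `W₁` need not be differentiable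
    -- everywhere.
    have h4 : w t = (Q t : ℂ) * v t - z * v t := by linear_combination -h1
    rw [h4]
    simp only [Complex.real_smul]
    push_cast
    ring

theorem hasDerivAt_quotient (h : IsDecayingProfile W W₁) (hv : HasACSecondDeriv v v₁ w) :
    ∀ t > 0, HasDerivAt (fun t => v t / (W t : ℂ))
      ((W t • v₁ t - W₁ t • v t) / (W t : ℂ) ^ 2) t := by
  intro t ht
  have hp : (W t : ℂ) ≠ 0 := by simpa using (h.pos ht).ne'
  refine ((hv.hasDerivAt t ht).div (h.hasDeriv t ht).ofReal_comp hp).congr_deriv ?_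
  simp only [Complex.real_smul]
  ring

theorem quotient_tendsto_zero (h : IsDecayingProfile W W₁) (hv : HasACSecondDeriv v v₁ w)
    (h0 : v 0 = 0) : Tendsto (fun t => v t / (W t : ℂ)) (𝓝[>] 0) (𝓝 0) := by
  obtain ⟨c, hc, hl⟩ := h.lower
  refine squeeze_zero_norm' (a := fun t => ‖v t‖ / c) ?_
    (by simpa using (hv.tendsto_zero h0).norm.div_const c)
  filter_upwards [self_mem_nhdsWithin] with t ht
  have hp := h.pos ht
  have := hl t ht
  rw [norm_div, Complex.norm_real, Real.norm_of_nonneg hp.le]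
  gcongr

/-- A square integrable solution of the eigenvalue equation with `v 0 = 0` is trivial unless the
spectral parameter lies in the real interval `(-ν², 0)`. -/
theorem eq_zero_or_mem_Ioo (h : IsDecayingProfile W W₁) (hW : SolvesProfileEq Q W W₁ ν)
    (hν : 0 ≤ ν) (hv : HasACSecondDeriv v v₁ w) (h0 : v 0 = 0)
    (he : ∀ᵐ t ∂(volume.restrict (Ioi (0 : ℝ))), -w t + (Q t : ℂ) * v t = z * v t)
    (hint : IntegrableOn (fun t => ‖v t‖ ^ 2) (Ioi 0)) :
    (∀ t > 0, v t = 0) ∨ z ∈ (fun x : ℝ => (x : ℂ)) '' Ioo (-ν ^ 2) 0 := by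
  obtain ⟨c, hc, hl⟩ := h.lower
  set s : ℝ → ℂ := fun t => v t / (W t : ℂ) with hsdef
  set m : ℝ → ℂ := fun t => W t • v₁ t - W₁ t • v t with hmdef
  have hWne : ∀ t > 0, (W t : ℂ) ≠ 0 := fun t ht => by simpa using (h.pos ht).ne'
  have hvs : ∀ t > 0, v t = W t * s t := fun t ht => by
    simp only [hsdef]; rw [mul_div_cancel₀ _ (hWne t ht)]
  have hs : ∀ t > 0, HasDerivAt s (m t / (W t : ℂ) ^ 2) t := h.hasDerivAt_quotient hv
  have hm : ∀ t > 0, HasDerivAt m (-(z * W t + 2 * ν * W₁ t) * v t) t :=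
    h.hasDerivAt_wronskian hW hv he
  have hsub : Ioi (1 : ℝ) ⊆ Ioi 0 := Ioi_subset_Ioi zero_le_one
  have hsc : ContinuousOn s (Ioi 0) := fun t ht => (hs t ht).continuousAt.continuousWithinAt
  have hsint : IntegrableOn (fun t => ‖s t‖ ^ 2) (Ioi 1) := by
    refine Integrable.mono' ((hint.mono_set hsub).const_mul ((1 / c) ^ 2))
      (((hsc.norm.pow 2).mono hsub).aestronglyMeasurable measurableSet_Ioi) ?_
    filter_upwards [ae_restrict_mem measurableSet_Ioi] with t ht
    have hp := h.pos (hsub ht)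
    have h1 := hl t (hsub ht)
    rw [Real.norm_of_nonneg (by positivity), ← mul_pow, one_div_mul_eq_div]
    simp only [hsdef, norm_div, Complex.norm_real, Real.norm_of_nonneg hp.le]
    gcongr
  have hE : ∀ t : ℝ, (Real.exp (-ν * t) : ℂ) * Real.exp (ν * t) = 1 := by
    intro t
    rw [← Complex.ofReal_mul, ← Real.exp_add]
    simp
  -- With `φ = e^{-νt} W` this function is `y = v/φ`, and `φ² y' = e^{-νt}(m + νW² s)` plays the
  -- role of `n`.
  have hy : ∀ t > 0, HasDerivAt (fun t => (Real.exp (ν * t) : ℂ) * s t)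
      ((Real.exp (-ν * t) : ℂ) * (m t + ν * (W t : ℂ) ^ 2 * s t) /
        ((Real.exp (-ν * t) * W t : ℝ) : ℂ) ^ 2) t := by
    intro t ht
    have e : HasDerivAt (fun t : ℝ => (Real.exp (ν * t) : ℂ)) ((Real.exp (ν * t) * ν : ℝ) : ℂ) t := by
      simpa using (((hasDerivAt_id t).const_mul ν).exp).ofReal_comp
    refine (e.mul (hs t ht)).congr_deriv ?_
    have h1 := hWne t ht
    have h2 : (Real.exp (-ν * t) : ℂ) ≠ 0 := by simp
    have h3 : (Real.exp (ν * t) : ℂ) = 1 / Real.exp (-ν * t) := by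
      rw [eq_div_iff h2, mul_comm]; exact hE t
    push_cast [h3] at *
    rw [h3]
    field_simp
    ring
  have hn : ∀ t > 0, HasDerivAt (fun t => (Real.exp (-ν * t) : ℂ) *
      (m t + ν * (W t : ℂ) ^ 2 * s t))
      (-(z + ν ^ 2) * ((Real.exp (-ν * t) * W t : ℝ) : ℂ) ^ 2 *
        ((Real.exp (ν * t) : ℂ) * s t)) t := by
    intro t ht
    have e : HasDerivAt (fun t : ℝ => (Real.exp (-ν * t) : ℂ))
        ((Real.exp (-ν * t) * -ν : ℝ) : ℂ) t := by
      simpa using (((hasDerivAt_id t).const_mul (-ν)).exp).ofReal_comp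
    have e2 := ((h.hasDeriv t ht).ofReal_comp.pow 2).const_mul (ν : ℂ)
    refine (e.mul ((hm t ht).add (e2.mul (hs t ht)))).congr_deriv ?_
    have h1 := hWne t ht
    have h2 : (W t : ℂ) ^ 2 * (m t / (W t : ℂ) ^ 2) = m t := mul_div_cancel₀ _ (pow_ne_zero 2 h1)
    have h3 := hE t
    rw [hvs t ht]
    clear_value s m
    simp only [Pi.pow_apply, Pi.add_apply, Pi.mul_apply, Complex.ofReal_mul, Complex.ofReal_neg]
    push_cast [-Complex.ofReal_exp]
    linear_combination ((z + ν ^ 2) * Real.exp (-ν * t) * (W t : ℂ) ^ 2 * s t) * h3 +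
      ν * Real.exp (-ν * t) * h2
  have hyint : IntegrableOn (fun t => (Real.exp (-ν * t) * W t) ^ 2 *
      ‖(Real.exp (ν * t) : ℂ) * s t‖ ^ 2) (Ioi 1) := by
    refine (hint.mono_set hsub).congr_fun (fun t ht => ?_) measurableSet_Ioi
    have hp := h.pos (hsub ht)
    have h1 : Real.exp (-ν * t) * Real.exp (ν * t) = 1 := by
      rw [← Real.exp_add]; simp
    simp only
    rw [hvs t (hsub ht), norm_mul, norm_mul, Complex.norm_real, Complex.norm_real,
      Real.norm_of_nonneg hp.le, Real.norm_of_nonneg (Real.exp_pos _).le]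
    linear_combination -(Real.exp (-ν * t) * Real.exp (ν * t) + 1) * (W t * ‖s t‖) ^ 2 * h1
  have hy0 : Tendsto (fun t => (Real.exp (ν * t) : ℂ) * s t) (𝓝[>] 0) (𝓝 0) := by
    have h1 : Tendsto (fun t : ℝ => (Real.exp (ν * t) : ℂ)) (𝓝[>] 0)
        (𝓝 ((Real.exp (ν * 0) : ℝ) : ℂ)) :=
      ((by fun_prop : Continuous fun t : ℝ => (Real.exp (ν * t) : ℂ)).tendsto 0).mono_left
        nhdsWithin_le_nhds
    simpa using h1.mul (h.quotient_tendsto_zero hv h0)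
  rcases (h.isWeight hν).eq_zero_or_neg hy hn hy0 hyint with hz | ⟨him, hre⟩
  · left
    intro t ht
    have := hz t ht
    simp only [mul_eq_zero, Complex.ofReal_eq_zero, (Real.exp_pos _).ne', false_or] at this
    rw [hvs t ht, this, mul_zero]
  have him' : z.im = 0 := by
    rw [← Complex.ofReal_pow] at him
    simp only [Complex.neg_im, Complex.add_im, Complex.ofReal_im] at him
    linarith
  have hre' : -ν ^ 2 < z.re := by
    rw [← Complex.ofReal_pow] at hre
    simp only [Complex.neg_re, Complex.add_re, Complex.ofReal_re] at hre
    linarith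
  have hzre : z = (z.re : ℂ) := Complex.ext rfl (by simp [him'])
  rcases lt_or_ge z.re 0 with hlt | hge
  · exact Or.inr ⟨z.re, ⟨hre', hlt⟩, hzre.symm⟩
  left
  have hm' : ∀ t > 0, HasDerivAt m
      (((-(z.re * W t ^ 2 + 2 * ν * W t * W₁ t) : ℝ) : ℂ) * s t) t := by
    intro t ht
    refine (hm t ht).congr_deriv ?_
    rw [hvs t ht]
    push_cast
    rw [← hzre]
    ring
  -- Only real `z ≥ 0` is left. Here the weight `W`, bounded below, replaces `φ`.
  have hs0 : ∀ t > 0, s t = 0 := by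
    rcases hge.eq_or_lt with heq | hlt
    · rw [← heq] at hm'
      exact h.eq_zero_of_zero hs hm' hsint
    · exact h.eq_zero_of_pos hlt hs hm' hsint
  intro t ht
  rw [hvs t ht, hs0 t ht, mul_zero]

/-- For `ν = 0`, there is no zero resonance. -/
theorem not_hasZeroResonance (h : IsDecayingProfile W W₁) (hW : SolvesProfileEq Q W W₁ 0) :
    ¬ HasZeroResonance Q := by
  rintro ⟨ψ, ⟨⟨ψ₁, w, hv, he⟩, hlim⟩, h0⟩
  obtain ⟨c, hc, hl⟩ := h.lower
  obtain ⟨C, hu⟩ := h.upper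
  have hlim' : Tendsto ψ atTop (𝓝 1) := by simpa using hlim
  set s : ℝ → ℂ := fun t => ψ t / (W t : ℂ) with hsdef
  set m : ℝ → ℂ := fun t => W t • ψ₁ t - W₁ t • ψ t with hmdef
  have hs : ∀ t > 0, HasDerivAt s (m t / (W t : ℂ) ^ 2) t := h.hasDerivAt_quotient hv
  have hm : ∀ t > 0, HasDerivAt m 0 t := by
    intro t ht
    exact (h.hasDerivAt_wronskian (z := 0) hW hv (by simpa using he) t ht).congr_deriv (by simp)
  have hmk : ∀ t > 0, m t = m 1 := fun t ht => eq_of_hasDerivAt_zero hm ht one_pos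
  have hbd : ∀ᶠ t in atTop, ‖s t‖ ≤ 2 / c := by
    have h1 := hlim'.norm.eventually (ge_mem_nhds (by simp : ‖(1 : ℂ)‖ < 2))
    filter_upwards [h1, eventually_gt_atTop 0] with t ht ht0
    have hp := h.pos ht0
    have := hl t ht0
    simp only [hsdef, norm_div, Complex.norm_real, Real.norm_of_nonneg hp.le]
    gcongr
  -- The Wronskian is constant. If it is zero, `ψ/W` is constant and vanishes at `0`, contrary to `ψ
  -- → 1`; otherwise `(ψ/W)' = m/W²` forces linear growth, contrary to boundedness.
  by_cases hk : m 1 = 0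
  · have hz : ∀ t > 0, s t = 0 := by
      refine eq_zero_of_hasDerivAt_zero (fun t ht => ?_) (h.quotient_tendsto_zero hv h0)
      simpa [hmk t ht, hk] using hs t ht
    have h2 : Tendsto ψ atTop (𝓝 0) := by
      refine Tendsto.congr' ?_ tendsto_const_nhds
      filter_upwards [eventually_gt_atTop 0] with t ht
      have := hz t ht
      simp only [hsdef, div_eq_zero_iff, Complex.ofReal_eq_zero, (h.pos ht).ne', or_false] at this
      exact this.symm
    exact zero_ne_one (tendsto_nhds_unique h2 hlim')
  · have hkpos : 0 < ‖m 1‖ := norm_pos_iff.2 hk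
    have hC : 0 < C := hc.trans_le ((hl 1 one_pos).trans (hu 1 one_pos))
    have hd : ∀ t > 0, HasDerivAt (fun t => (s t * conj (m 1)).re) (‖m 1‖ ^ 2 / W t ^ 2) t := by
      intro t ht
      refine (hasDerivAt_re ((hs t ht).mul_const (conj (m 1)))).congr_deriv ?_
      rw [hmk t ht, div_mul_eq_mul_div, Complex.mul_conj', ← Complex.ofReal_pow,
        ← Complex.ofReal_pow, ← Complex.ofReal_div, Complex.ofReal_re]
    have hgrow : ∀ t > 1, ‖m 1‖ ^ 2 / C ^ 2 * (t - 1) ≤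
        (s t * conj (m 1)).re - (s 1 * conj (m 1)).re := by
      intro t ht
      refine (convex_Ioi (0 : ℝ)).mul_sub_le_image_sub_of_le_deriv
        (f := fun t => (s t * conj (m 1)).re)
        (fun r hr => (hd r hr).continuousAt.continuousWithinAt) ?_ ?_ 1 (mem_Ioi.2 one_pos) t
        (mem_Ioi.2 (one_pos.trans ht)) ht.le
      · rw [interior_Ioi]
        exact fun r hr => (hd r hr).differentiableAt.differentiableWithinAt
      · rw [interior_Ioi]
        intro r hr
        rw [(hd r hr).deriv]
        have hp := h.pos hr
        have := hu r hr
        gcongr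
    have hκ : 0 < ‖m 1‖ ^ 2 / C ^ 2 := by positivity
    have htop : Tendsto (fun t : ℝ => ‖m 1‖ ^ 2 / C ^ 2 * (t - 1)) atTop atTop :=
      (tendsto_atTop_add_const_right _ _ tendsto_id).const_mul_atTop hκ
    obtain ⟨t, ⟨ht1, ht2⟩, ht3⟩ := ((hbd.and (eventually_gt_atTop 1)).and
      (htop.eventually_gt_atTop (2 / c * ‖m 1‖ - (s 1 * conj (m 1)).re))).exists
    have h3 := hgrow t ht2
    have h4 : (s t * conj (m 1)).re ≤ 2 / c * ‖m 1‖ := by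
      refine (Complex.re_le_norm _).trans ?_
      rw [norm_mul, RCLike.norm_conj]
      gcongr
    linarith

end IsDecayingProfile

/-! ### From the point spectrum to solutions of the differential equation. -/

/-- The eigenfunctions of `H_Q`, written with representatives. -/
theorem exists_solution_of_mem_pointSpectrum {Q : ℝ → ℝ} {z : ℂ}
    (hz : z ∈ opPointSpectrum (schrodingerOp Q)) :
    ∃ v v₁ w : ℝ → ℂ, HasACSecondDeriv v v₁ w ∧ v 0 = 0 ∧
      (∀ᵐ t ∂(volume.restrict (Ioi (0 : ℝ))), -w t + (Q t : ℂ) * v t = z * v t) ∧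
      IntegrableOn (fun t => ‖v t‖ ^ 2) (Ioi 0) ∧ ¬ ∀ t > 0, v t = 0 := by
  obtain ⟨u, hu, hne⟩ := (Submodule.ne_bot_iff _).1 hz
  have hu' : (u, z • u) ∈ schrodingerGraph Q := by
    rw [← schrodingerOp_graph]; exact hu
  obtain ⟨v, v₁, w, hv, h0, huv, hf⟩ := hu'
  refine ⟨v, v₁, w, hv, h0, ?_, ?_, ?_⟩
  · filter_upwards [huv, hf, Lp.coeFn_smul z u] with t h1 h2 h3
    rw [← h2, h3, Pi.smul_apply, h1, smul_eq_mul]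
  · have h1 : MemLp v 2 (volume.restrict (Ioi 0)) := (memLp_congr_ae huv).1 (Lp.memLp u)
    exact (memLp_two_iff_integrable_sq_norm h1.1).1 h1
  · intro hz0
    refine hne ((Lp.eq_zero_iff_ae_eq_zero).2 ?_)
    filter_upwards [huv, ae_restrict_mem measurableSet_Ioi] with t h1 ht
    rw [h1, hz0 t ht]
    rfl

theorem opDiscreteSpectrum_subset_pointSpectrum {H : Type*} [NormedAddCommGroup H]
    [NormedSpace ℂ H] (T : H →ₗ.[ℂ] H) : opDiscreteSpectrum T ⊆ opPointSpectrum T :=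
  fun _ hz => hz.2.2.1

/-! ### Weak derivatives on the unit interval -/

/-- The bounds `1/4` and `3/4` leave room for the support of the fixed bump in
`hasDerivAt_of_weak_deriv`, so that one interval serves both functions. -/
theorem exists_Ioo_of_tsupport_subset {k : ℝ → ℝ} (hk : HasCompactSupport k)
    (hs : tsupport k ⊆ Ioo 0 1) :
    ∃ a b : ℝ, 0 < a ∧ a < 1 / 4 ∧ 3 / 4 < b ∧ b < 1 ∧ tsupport k ⊆ Ioo a b := by
  have hc : IsCompact (tsupport k) := hk
  rcases (tsupport k).eq_empty_or_nonempty with he | hne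
  · exact ⟨1 / 8, 7 / 8, by norm_num, by norm_num, by norm_num, by norm_num, by simp [he]⟩
  have h1 := hs (hc.sInf_mem hne)
  have h2 := hs (hc.sSup_mem hne)
  refine ⟨min (1 / 8) (sInf (tsupport k) / 2), max (7 / 8) ((sSup (tsupport k) + 1) / 2),
    lt_min (by norm_num) (by linarith [h1.1]), (min_le_left _ _).trans_lt (by norm_num),
    lt_of_lt_of_le (by norm_num) (le_max_left _ _), max_lt (by norm_num) (by linarith [h2.2]),
    fun x hx => ⟨?_, ?_⟩⟩
  · have := csInf_le hc.bddBelow hx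
    exact (min_le_right _ _).trans_lt (by linarith [h1.1])
  · have := le_csSup hc.bddAbove hx
    exact lt_of_lt_of_le (by linarith [h2.2]) (le_max_right _ _)

theorem integral_eq_intervalIntegral_of_forall_notMem {g : ℝ → ℝ} {a b : ℝ}
    (h : ∀ x, x ∉ Ioo a b → g x = 0) : ∫ x, g x = ∫ x in a..b, g x := by
  refine (intervalIntegral.integral_eq_integral_of_support_subset fun x hx => ?_).symm
  by_contra hcon
  exact hx (h x fun hm => hcon ⟨hm.1, hm.2.le⟩)

/-- **du Bois-Reymond lemma**: a continuous function with continuous weak derivative is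
continuously differentiable. -/
theorem hasDerivAt_of_weak_deriv {U b : ℝ → ℝ} (hU : ContinuousOn U (Ioo 0 1))
    (hb : ContinuousOn b (Ioo 0 1))
    (h : ∀ k : ℝ → ℝ, ContDiff ℝ ∞ k → HasCompactSupport k → tsupport k ⊆ Ioo 0 1 →
      ∫ r, U r * deriv k r = -∫ r, k r * b r) :
    ∀ r ∈ Ioo (0 : ℝ) 1, HasDerivAt U (b r) r := by
  have hhalf : (1 / 2 : ℝ) ∈ Ioo (0 : ℝ) 1 := by norm_num
  have hB : ∀ r ∈ Ioo (0 : ℝ) 1, HasDerivAt (fun r => ∫ x in (1 / 2)..r, b x) (b r) r := by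
    intro r hr
    have hsub : uIcc (1 / 2) r ⊆ Ioo 0 1 := (convex_Ioo 0 1).ordConnected.uIcc_subset hhalf hr
    exact intervalIntegral.integral_hasDerivAt_right (hb.mono hsub).intervalIntegrable
      (hb.stronglyMeasurableAtFilter isOpen_Ioo r hr) (hb.continuousAt (isOpen_Ioo.mem_nhds hr))
  set B : ℝ → ℝ := fun r => ∫ x in (1 / 2)..r, b x with hBdef
  have hBc : ContinuousOn B (Ioo 0 1) := fun r hr => (hB r hr).continuousAt.continuousWithinAt
  set D : ℝ → ℝ := fun r => U r - B r with hDdef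
  have hDc : ContinuousOn D (Ioo 0 1) := hU.sub hBc
  have hD : ∀ k : ℝ → ℝ, ContDiff ℝ ∞ k → HasCompactSupport k → tsupport k ⊆ Ioo 0 1 →
      ∫ r, D r * deriv k r = 0 := by
    intro k hk hkc hks
    obtain ⟨a, c, ha, ha', hc', hc, hsub⟩ := exists_Ioo_of_tsupport_subset hkc hks
    have hac : a ≤ c := by linarith
    have hI : uIcc a c ⊆ Ioo 0 1 := by
      rw [uIcc_of_le hac]; exact fun x hx => ⟨ha.trans_le hx.1, hx.2.trans_lt hc⟩
    have hk0 : ∀ x, x ∉ Ioo a c → k x = 0 := fun x hx =>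
      image_eq_zero_of_notMem_tsupport fun hm => hx (hsub hm)
    have hk1 : ∀ x, x ∉ Ioo a c → deriv k x = 0 := fun x hx =>
      Function.notMem_support.1 fun hm => hx (hsub (support_deriv_subset hm))
    have hkd : ∀ x, HasDerivAt k (deriv k x) x := fun x =>
      (hk.differentiable (by simp) x).hasDerivAt
    have hkdc : Continuous (deriv k) := hk.continuous_deriv (by simp)
    have e1 := h k hk hkc hks
    rw [integral_eq_intervalIntegral_of_forall_notMem (a := a) (b := c)
      (fun x hx => by rw [hk1 x hx, mul_zero]),
      integral_eq_intervalIntegral_of_forall_notMem (a := a) (b := c)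
      (fun x hx => by rw [hk0 x hx, zero_mul])] at e1
    have e2 := intervalIntegral.integral_mul_deriv_eq_deriv_mul (a := a) (b := c)
      (fun x hx => hB x (hI hx)) (fun x _ => hkd x) (hb.mono hI).intervalIntegrable
      (hkdc.intervalIntegrable _ _)
    rw [hk0 a (by simp), hk0 c (by simp)] at e2
    rw [integral_eq_intervalIntegral_of_forall_notMem (a := a) (b := c)
      (fun x hx => by rw [hk1 x hx, mul_zero])]
    simp only [hDdef, sub_mul]
    rw [intervalIntegral.integral_sub, e1, e2]
    · simp only [mul_comm (k _)]
      ring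
    · exact ((hU.mono hI).mul hkdc.continuousOn).intervalIntegrable
    · exact ((hBc.mono hI).mul hkdc.continuousOn).intervalIntegrable
  let ζ : ContDiffBump (1 / 2 : ℝ) := ⟨1 / 8, 1 / 4, by norm_num, by norm_num⟩
  set k₀ : ℝ → ℝ := ζ.normed volume with hk₀def
  have hk₀ : ContDiff ℝ ∞ k₀ := ζ.contDiff_normed
  have hk₀i : ∫ x, k₀ x = 1 := ζ.integral_normed
  have hk₀s : ∀ x, x ∉ Icc (1 / 4 : ℝ) (3 / 4) → k₀ x = 0 := by
    intro x hx
    refine image_eq_zero_of_notMem_tsupport fun hm => hx ?_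
    rw [hk₀def, ζ.tsupport_normed_eq, Real.closedBall_eq_Icc] at hm
    refine ⟨?_, ?_⟩
    · have := hm.1; norm_num [ζ] at this; linarith
    · have := hm.2; norm_num [ζ] at this; linarith
  set C : ℝ := ∫ x, D x * k₀ x with hCdef
  have hae : ∀ᵐ x ∂(volume : Measure ℝ), x ∈ Ioo (0 : ℝ) 1 → D x - C = 0 := by
    refine isOpen_Ioo.ae_eq_zero_of_integral_contDiff_smul_eq_zero
      ((hDc.sub continuousOn_const).locallyIntegrableOn measurableSet_Ioo) fun g hg hgc hgs => ?_
    obtain ⟨a, c, ha, ha', hc', hc, hsub⟩ := exists_Ioo_of_tsupport_subset hgc hgs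
    have hac : a ≤ c := by linarith
    have hg0 : ∀ x, x ∉ Ioo a c → g x = 0 := fun x hx =>
      image_eq_zero_of_notMem_tsupport fun hm => hx (hsub hm)
    have hk0 : ∀ x, x ∉ Ioo a c → k₀ x = 0 := fun x hx => hk₀s x fun hm =>
      hx ⟨by linarith [hm.1], by linarith [hm.2]⟩
    have hI : uIcc a c ⊆ Ioo 0 1 := by
      rw [uIcc_of_le hac]; exact fun x hx => ⟨ha.trans_le hx.1, hx.2.trans_lt hc⟩
    set J : ℝ := ∫ x, g x with hJ
    -- Subtracting `J k₀` makes the mean zero, so the primitive `k` has compact support in `(0, 1)`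
    -- and is an admissible test function with `k' = l`.
    set l : ℝ → ℝ := fun x => g x - J * k₀ x with hl
    have hlc : ContDiff ℝ ∞ l := hg.sub (contDiff_const.mul hk₀)
    have hl0 : ∀ x, x ∉ Ioo a c → l x = 0 := fun x hx => by simp [hl, hg0 x hx, hk0 x hx]
    set k : ℝ → ℝ := fun x => ∫ y in a..x, l y with hk
    have hkd : ∀ x, HasDerivAt k (l x) x := fun x =>
      intervalIntegral.integral_hasDerivAt_right (hlc.continuous.intervalIntegrable _ _)
        (hlc.continuous.stronglyMeasurableAtFilter _ _) hlc.continuous.continuousAt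
    have hkderiv : deriv k = l := funext fun x => (hkd x).deriv
    have hkc : ContDiff ℝ ∞ k := by
      rw [contDiff_infty_iff_deriv, hkderiv]
      exact ⟨fun x => (hkd x).differentiableAt, hlc⟩
    have hgi : Integrable g := hg.continuous.integrable_of_hasCompactSupport hgc
    have hl_int : ∫ y in a..c, l y = 0 := by
      rw [← integral_eq_intervalIntegral_of_forall_notMem hl0, hl,
        integral_sub hgi (ζ.integrable_normed.const_mul J), integral_const_mul, hk₀i]
      ring
    have hksub : Function.support k ⊆ Icc a c := by
      intro x hx
      by_contra hcon
      refine hx ?_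
      rcases lt_or_ge x a with hxa | hxa
      · simp only [hk]
        rw [intervalIntegral.integral_symm, intervalIntegral.integral_zero_ae, neg_zero]
        refine Eventually.of_forall fun y hy => hl0 y fun hm => ?_
        rw [uIoc_of_le hxa.le] at hy
        linarith [hy.2, hm.1]
      · have hxc : c < x := by
          by_contra hh
          exact hcon ⟨hxa, not_lt.1 hh⟩
        simp only [hk]
        rw [← intervalIntegral.integral_add_adjacent_intervals (b := c)
          (hlc.continuous.intervalIntegrable _ _) (hlc.continuous.intervalIntegrable _ _), hl_int,
          intervalIntegral.integral_zero_ae, add_zero]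
        refine Eventually.of_forall fun y hy => hl0 y fun hm => ?_
        rw [uIoc_of_le hxc.le] at hy
        linarith [hy.1, hm.2]
    have hkts : tsupport k ⊆ Icc a c := closure_minimal hksub isClosed_Icc
    have e := hD k hkc (HasCompactSupport.of_support_subset_isCompact isCompact_Icc hksub)
      (hkts.trans (by rwa [uIcc_of_le hac] at hI))
    rw [hkderiv, integral_eq_intervalIntegral_of_forall_notMem (a := a) (b := c)
      (fun x hx => by rw [hl0 x hx, mul_zero])] at e
    have hC' : C = ∫ x in a..c, D x * k₀ x :=
      integral_eq_intervalIntegral_of_forall_notMem (fun x hx => by rw [hk0 x hx, mul_zero])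
    have hJ' : J = ∫ x in a..c, g x := integral_eq_intervalIntegral_of_forall_notMem hg0
    have hDi : ContinuousOn D (uIcc a c) := hDc.mono hI
    have i1 : IntervalIntegrable (fun x => D x * g x) volume a c :=
      (hDi.mul hg.continuous.continuousOn).intervalIntegrable
    have i2 : IntervalIntegrable (fun x => D x * k₀ x) volume a c :=
      (hDi.mul hk₀.continuous.continuousOn).intervalIntegrable
    rw [integral_eq_intervalIntegral_of_forall_notMem (a := a) (b := c)
      (fun x hx => by rw [hg0 x hx, zero_smul])]
    have e3 : ∀ x, D x * l x = D x * g x - J * (D x * k₀ x) := fun x => by simp only [hl]; ring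
    simp only [e3] at e
    rw [intervalIntegral.integral_sub i1 (i2.const_mul J), intervalIntegral.integral_const_mul,
      ← hC'] at e
    have e4 : ∀ x, g x • (D x - C) = D x * g x - C * g x := fun x => by
      rw [smul_eq_mul]; ring
    simp only [e4]
    rw [intervalIntegral.integral_sub i1 ((hg.continuous.intervalIntegrable _ _).const_mul C),
      intervalIntegral.integral_const_mul, ← hJ']
    linarith
  have heq : EqOn D (fun _ => C) (Ioo 0 1) := by
    refine Measure.eqOn_open_of_ae_eq (μ := volume) ?_ isOpen_Ioo hDc continuousOn_const
    rw [EventuallyEq, ae_restrict_iff' measurableSet_Ioo]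
    filter_upwards [hae] with x hx hm
    exact sub_eq_zero.1 (hx hm)
  intro r hr
  refine ((hB r hr).add_const C).congr_of_eventuallyEq ?_
  filter_upwards [isOpen_Ioo.mem_nhds hr] with x hx
  have := heq hx
  simp only [hDdef] at this
  linarith

/-! ### Laplacian and radial functions -/

variable {d : ℕ}

theorem laplacian_eq_sum_fderiv {φ : EuclideanSpace ℝ (Fin d) → ℝ} (hφ : ContDiff ℝ ∞ φ)
    (x : EuclideanSpace ℝ (Fin d)) :
    Laplacian.laplacian φ x = ∑ i, fderiv ℝ
      (fun y => fderiv ℝ φ y (EuclideanSpace.single i 1)) x (EuclideanSpace.single i 1) := by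
  have h1 := congrFun (InnerProductSpace.laplacian_eq_iteratedFDeriv_orthonormalBasis φ
    (EuclideanSpace.basisFun (Fin d) ℝ)) x
  refine h1.trans (Finset.sum_congr rfl fun i _ => ?_)
  have hd : DifferentiableAt ℝ (fderiv ℝ φ) x :=
    (hφ.fderiv_right (m := ∞) (by simp)).differentiable (by simp) x
  rw [iteratedFDeriv_two_apply]
  rw [fderiv_clm_apply hd (differentiableAt_const _)]
  simp

theorem hasFDerivAt_comp_norm_sq {G G' : ℝ → ℝ} (hG : ∀ ρ, HasDerivAt G (G' ρ) ρ)
    (x : EuclideanSpace ℝ (Fin d)) :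
    HasFDerivAt (fun x : EuclideanSpace ℝ (Fin d) => G (‖x‖ ^ 2))
      (G' (‖x‖ ^ 2) • (2 • (innerSL ℝ x))) x :=
  (hG _).comp_hasFDerivAt x (hasStrictFDerivAt_norm_sq x).hasFDerivAt

theorem laplacian_comp_norm_sq {G G' G'' : ℝ → ℝ} (hGc : ContDiff ℝ ∞ G)
    (hG : ∀ ρ, HasDerivAt G (G' ρ) ρ) (hG' : ∀ ρ, HasDerivAt G' (G'' ρ) ρ)
    (x : EuclideanSpace ℝ (Fin d)) :
    Laplacian.laplacian (fun x : EuclideanSpace ℝ (Fin d) => G (‖x‖ ^ 2)) x =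
      4 * ‖x‖ ^ 2 * G'' (‖x‖ ^ 2) + 2 * d * G' (‖x‖ ^ 2) := by
  rw [laplacian_eq_sum_fderiv (φ := fun x : EuclideanSpace ℝ (Fin d) => G (‖x‖ ^ 2))
    (hGc.comp (contDiff_norm_sq ℝ))]
  have h1 : ∀ i, fderiv ℝ (fun y => fderiv ℝ (fun x : EuclideanSpace ℝ (Fin d) => G (‖x‖ ^ 2)) y
      (EuclideanSpace.single i 1)) x (EuclideanSpace.single i 1) =
      4 * x i ^ 2 * G'' (‖x‖ ^ 2) + 2 * G' (‖x‖ ^ 2) := by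
    intro i
    have e : (fun y => fderiv ℝ (fun x : EuclideanSpace ℝ (Fin d) => G (‖x‖ ^ 2)) y
        (EuclideanSpace.single i 1)) = fun y => G' (‖y‖ ^ 2) * (2 * y i) := by
      ext y
      rw [(hasFDerivAt_comp_norm_sq hG y).fderiv]
      simp [EuclideanSpace.inner_single_right]
    rw [e]
    have hp : HasFDerivAt (fun y : EuclideanSpace ℝ (Fin d) => 2 * y i)
        ((2 : ℝ) • (EuclideanSpace.proj i : EuclideanSpace ℝ (Fin d) →L[ℝ] ℝ)) x :=
      ((EuclideanSpace.proj i : EuclideanSpace ℝ (Fin d) →L[ℝ] ℝ).hasFDerivAt).const_mul 2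
    have hm := ((hasFDerivAt_comp_norm_sq hG' x).fun_mul hp).fderiv
    rw [hm]
    simp [EuclideanSpace.inner_single_right]
    ring
  simp only [h1]
  rw [Finset.sum_add_distrib, ← Finset.sum_mul, ← Finset.mul_sum, EuclideanSpace.norm_sq_eq]
  simp
  ring

/-- The integral of `f` over the ball of radius `r` around the origin. -/
noncomputable def ballIntegral (f : EuclideanSpace ℝ (Fin d) → ℝ) (r : ℝ) : ℝ :=
  ∫ x in Metric.ball 0 r, f x

/-- The surface area of the unit sphere. -/
noncomputable def sphereArea (d : ℕ) : ℝ :=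
  d * volume.real (Metric.ball (0 : EuclideanSpace ℝ (Fin d)) 1)

theorem sphereArea_pos (hd : d ≠ 0) : 0 < sphereArea d := by
  have h1 : 0 < volume.real (Metric.ball (0 : EuclideanSpace ℝ (Fin d)) 1) :=
    ENNReal.toReal_pos (Metric.measure_ball_pos volume 0 one_pos).ne' measure_ball_lt_top.ne
  have h2 : (0 : ℝ) < d := by exact_mod_cast Nat.pos_of_ne_zero hd
  exact mul_pos h2 h1

theorem integral_fun_norm_eq [Nontrivial (EuclideanSpace ℝ (Fin d))] (g : ℝ → ℝ) :
    ∫ x : EuclideanSpace ℝ (Fin d), g ‖x‖ =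
      sphereArea d * ∫ r in Ioi (0 : ℝ), r ^ (d - 1) * g r := by
  rw [integral_fun_norm_addHaar volume g, finrank_euclideanSpace_fin, nsmul_eq_mul, smul_eq_mul,
    ← mul_assoc]
  rfl

/-- The weak Laplace equation, tested with a radial function. -/
theorem IsWeakLaplacian.radial_identity [Nontrivial (EuclideanSpace ℝ (Fin d))] (hd : d ≠ 0)
    {u f : EuclideanSpace ℝ (Fin d) → ℝ} {U : ℝ → ℝ} (hu : ∀ x ∈ unitBall d, u x = U ‖x‖)
    (hw : IsWeakLaplacian (unitBall d) u f) {k : ℝ → ℝ} (hk : ContDiff ℝ ∞ k)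
    (hkc : HasCompactSupport k) (hks : tsupport k ⊆ Ioo 0 1) :
    sphereArea d * ∫ r, U r * deriv k r = -∫ r, k r * ((r ^ (d - 1))⁻¹ * ballIntegral f r) := by
  obtain ⟨a, b, ha, ha', hb', hb, hsub⟩ := exists_Ioo_of_tsupport_subset hkc hks
  have hb0 : 0 < b := by linarith
  have hk0 : ∀ x, x ∉ Ioo a b → k x = 0 := fun x hx =>
    image_eq_zero_of_notMem_tsupport fun hm => hx (hsub hm)
  have hk1 : ∀ x, x ∉ Ioo a b → deriv k x = 0 := fun x hx =>
    Function.notMem_support.1 fun hm => hx (hsub (support_deriv_subset hm))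
  obtain ⟨e, he⟩ : ∃ e, d = e + 1 := Nat.exists_eq_succ_of_ne_zero hd
  -- Chosen so that the radial function `G(|x|²)` with `G' = h` has radial derivative
  -- `k(r)/r^{d-1}`. Its Laplacian is then `k'(r)/r^{d-1}`, and the factor `r^{d-1}` from polar
  -- coordinates cancels.
  set h : ℝ → ℝ := fun ρ => k (√ρ) * (2 * √ρ ^ d)⁻¹ with hh
  have hsmall : ∀ ρ < a ^ 2, h ρ = 0 := by
    intro ρ hρ
    have : √ρ < a := (Real.sqrt_lt' ha).2 hρ
    simp only [hh]
    rw [hk0 _ (fun hm => by linarith [hm.1]), zero_mul]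
  have hlarge : ∀ ρ, b ^ 2 ≤ ρ → h ρ = 0 := by
    intro ρ hρ
    have : b ≤ √ρ := Real.le_sqrt_of_sq_le hρ
    simp only [hh]
    rw [hk0 _ (fun hm => by linarith [hm.2]), zero_mul]
  have hhc : ContDiff ℝ ∞ h := by
    rw [contDiff_iff_contDiffAt]
    intro ρ
    rcases lt_or_ge ρ (a ^ 2) with hρ | hρ
    · refine (contDiffAt_const (c := (0 : ℝ))).congr_of_eventuallyEq ?_
      filter_upwards [Iio_mem_nhds hρ] with y hy using hsmall y hy
    · have hρ0 : 0 < ρ := (pow_pos ha 2).trans_le hρ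
      have h1 : ContDiffAt ℝ ∞ (fun x => √x) ρ := Real.contDiffAt_sqrt hρ0.ne'
      have h2 : ContDiffAt ℝ ∞ (fun x => k (√x)) ρ := hk.contDiffAt.comp ρ h1
      refine h2.mul ((contDiffAt_const.mul (h1.pow d)).inv ?_)
      have := Real.sqrt_pos.2 hρ0
      positivity
  have hhd : ∀ ρ, HasDerivAt h (deriv h ρ) ρ := fun ρ =>
    (hhc.differentiable (by simp) ρ).hasDerivAt
  have hkh : ∀ y > 0, k y = 2 * y ^ d * h (y ^ 2) := by
    intro y hy
    simp only [hh]
    rw [Real.sqrt_sq hy.le]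
    field_simp
  -- Starting the primitive at `1 ≥ b²` makes `G(|x|²)` vanish outside the ball of radius `b`. Near
  -- the origin it is constant, and smoothness holds because it depends on `|x|²`.
  set G : ℝ → ℝ := fun ρ => ∫ y in (1 : ℝ)..ρ, h y with hG
  have hGd : ∀ ρ, HasDerivAt G (h ρ) ρ := fun ρ =>
    intervalIntegral.integral_hasDerivAt_right (hhc.continuous.intervalIntegrable _ _)
      (hhc.continuous.stronglyMeasurableAtFilter _ _) hhc.continuous.continuousAt
  have hGc : ContDiff ℝ ∞ G := by
    rw [contDiff_infty_iff_deriv, funext fun x => (hGd x).deriv]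
    exact ⟨fun x => (hGd x).differentiableAt, hhc⟩
  have hb1 : b ^ 2 ≤ 1 := by nlinarith
  have hG0 : ∀ ρ, b ^ 2 ≤ ρ → G ρ = 0 := by
    intro ρ hρ
    simp only [hG]
    refine intervalIntegral.integral_zero_ae (Eventually.of_forall fun y hy => hlarge y ?_)
    exact (le_min hb1 hρ).trans hy.1.le
  set φ : EuclideanSpace ℝ (Fin d) → ℝ := fun x => G (‖x‖ ^ 2) with hφ
  have hφ0 : ∀ x, x ∉ Metric.closedBall (0 : EuclideanSpace ℝ (Fin d)) b → φ x = 0 := by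
    intro x hx
    rw [mem_closedBall_zero_iff, not_le] at hx
    exact hG0 _ (by gcongr)
  have hφs : Function.support φ ⊆ Metric.closedBall 0 b := by
    intro x hx
    by_contra hcon
    exact hx (hφ0 x hcon)
  have hbb : Metric.closedBall (0 : EuclideanSpace ℝ (Fin d)) b ⊆ unitBall d :=
    Metric.closedBall_subset_ball hb
  have hφt : IsTestFunction (unitBall d) φ :=
    ⟨hGc.comp (contDiff_norm_sq ℝ),
      HasCompactSupport.of_support_subset_isCompact (isCompact_closedBall 0 b) hφs,
      (closure_minimal hφs Metric.isClosed_closedBall).trans hbb⟩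
  have key := hw.2.2 φ hφt
  have hL : ∫ x in unitBall d, u x * Laplacian.laplacian φ x =
      sphereArea d * ∫ r, U r * deriv k r := by
    set g : ℝ → ℝ := (Iio 1).indicator
      fun r => U r * (4 * r ^ 2 * deriv h (r ^ 2) + 2 * d * h (r ^ 2)) with hg
    have e1 : ∫ x in unitBall d, u x * Laplacian.laplacian φ x =
        ∫ x : EuclideanSpace ℝ (Fin d), g ‖x‖ := by
      rw [← integral_indicator measurableSet_ball]
      refine integral_congr_ae (Eventually.of_forall fun x => ?_)
      simp only [hg]
      by_cases hx : x ∈ unitBall d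
      · have hx' : ‖x‖ ∈ Iio (1 : ℝ) := mem_ball_zero_iff.1 hx
        rw [indicator_of_mem hx, indicator_of_mem hx', hu x hx, hφ,
          laplacian_comp_norm_sq hGc hGd hhd]
      · have hx' : ‖x‖ ∉ Iio (1 : ℝ) := fun hm => hx (mem_ball_zero_iff.2 hm)
        rw [indicator_of_notMem hx, indicator_of_notMem hx']
    rw [e1, integral_fun_norm_eq]
    congr 1
    rw [← setIntegral_eq_integral_of_forall_compl_eq_zero (s := Ioi (0 : ℝ))
      (f := fun r => U r * deriv k r)
      (fun r hr => by rw [hk1 r (fun hm => hr (ha.trans hm.1)), mul_zero])]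
    refine setIntegral_congr_fun measurableSet_Ioi fun y hy => ?_
    have hy0 : (0 : ℝ) < y := hy
    simp only [hg]
    by_cases hy1 : y < 1
    · rw [indicator_of_mem (mem_Iio.2 hy1)]
      have e2 : deriv k y = 2 * (d * y ^ (d - 1)) * h (y ^ 2) +
          2 * y ^ d * (deriv h (y ^ 2) * (2 * y)) := by
        have h3 : HasDerivAt (fun y => 2 * y ^ d * h (y ^ 2)) (2 * (d * y ^ (d - 1)) * h (y ^ 2) +
          2 * y ^ d * (deriv h (y ^ 2) * (2 * y))) y := by
          refine ((hasDerivAt_pow d y).const_mul 2).mul (HasDerivAt.comp y (hhd _) ?_)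
          simpa using hasDerivAt_pow 2 y
        refine (h3.congr_of_eventuallyEq ?_).deriv
        filter_upwards [Ioi_mem_nhds hy0] with z hz using hkh z hz
      rw [e2, he]
      simp only [Nat.add_sub_cancel]
      ring
    · rw [indicator_of_notMem (show y ∉ Iio 1 from hy1), hk1 y (fun hm => hy1 (hm.2.trans hb))]
      simp
  set κ : ℝ → ℝ := fun r => h (r ^ 2) * (2 * r) with hκ
  have hκc : Continuous κ := by
    have := hhc.continuous
    fun_prop
  have hκs : HasCompactSupport κ := by
    refine HasCompactSupport.of_support_subset_isCompact (isCompact_Icc (a := -b) (b := b))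
      fun r hr => ?_
    by_contra hcon
    refine hr ?_
    have : b ^ 2 ≤ r ^ 2 := by
      rw [mem_Icc, ← abs_le, not_le] at hcon
      rw [← sq_abs r]
      gcongr
    simp [hκ, hlarge _ this]
  have hκi : Integrable κ := hκc.integrable_of_hasCompactSupport hκs
  have hκk : ∀ r > 0, κ r = k r * (r ^ (d - 1))⁻¹ := by
    intro r hr
    simp only [hκ]
    rw [hkh r hr, he]
    simp only [Nat.add_sub_cancel]
    field_simp
    ring
  have hGκ : ∀ r₀ : ℝ, 0 ≤ r₀ → G (r₀ ^ 2) = -∫ r, (Ioi r₀).indicator κ r := by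
    intro r₀ hr₀
    rw [integral_indicator measurableSet_Ioi,
      integral_Ioi_of_hasDerivAt_of_tendsto' (f := fun r => G (r ^ 2)) (m := 0) (fun r _ => ?_)
        hκi.integrableOn ?_]
    · ring
    · refine Tendsto.congr' ?_ tendsto_const_nhds
      filter_upwards [eventually_ge_atTop b] with r hr
      exact (hG0 _ (by gcongr)).symm
    · refine HasDerivAt.comp r (hGd _) ?_
      simpa using hasDerivAt_pow 2 r
  have hR : ∫ x in unitBall d, f x * φ x =
      -∫ r, k r * ((r ^ (d - 1))⁻¹ * ballIntegral f r) := by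
    -- Since `f` is only locally integrable in the open ball, it is cut off before Fubini's theorem
    -- is applied; the test function vanishes beyond radius `b`. Writing `φ(x) = -∫_{|x|}^∞ κ` and
    -- exchanging the integrals produces the integrals of `f` over balls.
    set f' : EuclideanSpace ℝ (Fin d) → ℝ := (Metric.closedBall 0 b).indicator f with hf'
    have hf'i : Integrable f' := (integrable_indicator_iff measurableSet_closedBall).2
      (hw.2.1.integrableOn_compact_subset hbb (isCompact_closedBall 0 b))
    set H : EuclideanSpace ℝ (Fin d) → ℝ → ℝ := fun x r =>
      {p : EuclideanSpace ℝ (Fin d) × ℝ | ‖p.1‖ < p.2}.indicator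
        (fun p => f' p.1 * κ p.2) (x, r) with hH
    have hHi : Integrable (Function.uncurry H) (volume.prod volume) :=
      (hf'i.mul_prod hκi).indicator (measurableSet_lt (by fun_prop) (by fun_prop))
    have e1 : ∫ x in unitBall d, f x * φ x = ∫ x, -∫ r, H x r := by
      rw [setIntegral_eq_integral_of_forall_compl_eq_zero
        (fun x hx => by rw [hφ0 x (fun hm => hx (hbb hm)), mul_zero])]
      refine integral_congr_ae (Eventually.of_forall fun x => ?_)
      simp only
      have e2 : ∀ r, H x r = f' x * (Ioi ‖x‖).indicator κ r := by
        intro r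
        by_cases hr : ‖x‖ < r
        · simp only [hH]
          rw [indicator_of_mem (mem_Ioi.2 hr), indicator_of_mem (by exact hr)]
        · simp only [hH]
          rw [indicator_of_notMem (show r ∉ Ioi ‖x‖ from hr), indicator_of_notMem (by exact hr), mul_zero]
      simp only [e2]
      rw [integral_const_mul, ← mul_neg, ← hGκ _ (norm_nonneg x)]
      by_cases hx : x ∈ Metric.closedBall (0 : EuclideanSpace ℝ (Fin d)) b
      · rw [hf', indicator_of_mem hx]
      · rw [hφ0 x hx, hf', indicator_of_notMem hx, zero_mul, mul_zero]
    rw [e1, integral_neg, integral_integral_swap hHi]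
    congr 1
    refine integral_congr_ae (Eventually.of_forall fun r => ?_)
    simp only
    by_cases hr : r ∈ Ioo a b
    · have hr0 : 0 < r := ha.trans hr.1
      have e2 : ∀ x, H x r = κ r * (Metric.ball 0 r).indicator f x := by
        intro x
        by_cases hx : ‖x‖ < r
        · simp only [hH]
          rw [indicator_of_mem (mem_ball_zero_iff.2 hx), indicator_of_mem (by exact hx), hf',
            indicator_of_mem (mem_closedBall_zero_iff.2 (hx.trans hr.2).le), mul_comm]
        · simp only [hH]
          rw [indicator_of_notMem (fun hm => hx (mem_ball_zero_iff.1 hm)),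
            indicator_of_notMem (by exact hx), mul_zero]
      simp only [e2]
      rw [integral_const_mul, integral_indicator measurableSet_ball, hκk r hr0]
      unfold ballIntegral
      ring
    · rw [hk0 r hr, zero_mul]
      refine integral_eq_zero_of_ae (Eventually.of_forall fun x => ?_)
      simp only [hH, Pi.zero_apply]
      by_cases hx : ‖x‖ < r
      · rw [indicator_of_mem (by exact hx), hκk r ((norm_nonneg x).trans_lt hx), hk0 r hr]
        ring
      · rw [indicator_of_notMem (by exact hx)]
  rw [← hL, key, hR]

/-- Dominated convergence: as `r → r₀` the indicators of the balls converge off the sphere of radius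
`r₀`, which is null. -/
theorem continuousOn_ballIntegral [Nontrivial (EuclideanSpace ℝ (Fin d))]
    {f : EuclideanSpace ℝ (Fin d) → ℝ} (hf : LocallyIntegrableOn f (unitBall d)) :
    ContinuousOn (ballIntegral f) (Ioo 0 1) := by
  intro r₀ hr₀
  refine ContinuousAt.continuousWithinAt ?_
  obtain ⟨b, hb0, hb1⟩ := exists_between hr₀.2
  have hi : IntegrableOn f (Metric.closedBall 0 b) :=
    hf.integrableOn_compact_subset (Metric.closedBall_subset_ball hb1) (isCompact_closedBall 0 b)
  have e : ballIntegral f = fun r => ∫ x, (Metric.ball 0 r).indicator f x := by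
    ext r
    rw [integral_indicator measurableSet_ball]
    rfl
  rw [e]
  refine continuousAt_of_dominated (bound := (Metric.closedBall 0 b).indicator fun x => ‖f x‖)
    ?_ ?_ ((integrable_indicator_iff measurableSet_closedBall).2 hi.norm) ?_
  · filter_upwards [Iio_mem_nhds hb0] with r hr
    rw [aestronglyMeasurable_indicator_iff measurableSet_ball]
    exact (hi.mono_set (Metric.ball_subset_closedBall.trans
      (Metric.closedBall_subset_closedBall (le_of_lt hr)))).aestronglyMeasurable
  · filter_upwards [Iio_mem_nhds hb0] with r hr
    refine Eventually.of_forall fun x => ?_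
    rw [norm_indicator_eq_indicator_norm]
    exact indicator_le_indicator_of_subset (Metric.ball_subset_closedBall.trans
      (Metric.closedBall_subset_closedBall (le_of_lt hr))) (fun x => norm_nonneg _) x
  · have h0 : volume (Metric.sphere (0 : EuclideanSpace ℝ (Fin d)) r₀) = 0 :=
      Measure.addHaar_sphere _ _ _
    filter_upwards [measure_eq_zero_iff_ae_notMem.1 h0] with x hx
    rw [mem_sphere_zero_iff_norm] at hx
    rcases lt_or_gt_of_ne hx with hlt | hgt
    · refine (continuousAt_const (y := f x)).congr ?_
      filter_upwards [Ioi_mem_nhds hlt] with r hr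
      rw [indicator_of_mem (mem_ball_zero_iff.2 hr)]
    · refine (continuousAt_const (y := (0 : ℝ))).congr ?_
      filter_upwards [Iio_mem_nhds hgt] with r hr
      rw [indicator_of_notMem fun hm => ?_]
      exact lt_asymm hr (mem_ball_zero_iff.1 hm)

/-- A continuous radial function with weak Laplacian `f` is continuously differentiable away from
the origin, and its derivative is given by the divergence theorem. -/
theorem IsWeakLaplacian.hasDerivAt_radial [Nontrivial (EuclideanSpace ℝ (Fin d))] (hd : d ≠ 0)
    {u f : EuclideanSpace ℝ (Fin d) → ℝ} {U : ℝ → ℝ} (hu : ∀ x ∈ unitBall d, u x = U ‖x‖)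
    (hU : ContinuousOn U (Ioo 0 1)) (hw : IsWeakLaplacian (unitBall d) u f) :
    ∀ r ∈ Ioo (0 : ℝ) 1,
      HasDerivAt U ((r ^ (d - 1))⁻¹ * ballIntegral f r / sphereArea d) r := by
  have hσ := sphereArea_pos hd
  refine hasDerivAt_of_weak_deriv hU ?_ fun k hk hkc hks => ?_
  · refine (ContinuousOn.mul (ContinuousOn.inv₀ (by fun_prop) fun r hr => ?_)
      (continuousOn_ballIntegral hw.2.1)).div_const _
    exact (pow_pos hr.1 _).ne'
  · have h1 := hw.radial_identity hd hu hk hkc hks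
    have h2 : ∀ r, k r * ((r ^ (d - 1))⁻¹ * ballIntegral f r / sphereArea d) =
        k r * ((r ^ (d - 1))⁻¹ * ballIntegral f r) * (sphereArea d)⁻¹ := fun r => by ring
    simp only [h2]
    rw [integral_mul_const, ← neg_mul, ← h1]
    field_simp

/-! ### Growth of ball integrals and the Laplacian of `W^{2,p}` functions. -/

/-- Hölder's inequality against the constant `1`. For `p = ⊤` the conventions `toReal ⊤ = 0` and `1
/ 0 = 0` yield the correct exponent `d`. -/
theorem ballIntegral_le_of_memLp [Nontrivial (EuclideanSpace ℝ (Fin d))] {p : ℝ≥0∞} (hp : 1 ≤ p)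
    {f : EuclideanSpace ℝ (Fin d) → ℝ} (hf : MemLp f p (volume.restrict (unitBall d))) :
    ∃ C, ∀ r ∈ Ioo (0 : ℝ) 1, |ballIntegral f r| ≤ C * r ^ (d * (1 - 1 / p.toReal)) := by
  set θ : ℝ := 1 - 1 / p.toReal with hθ
  have hθ0 : 0 ≤ θ := by
    rcases eq_or_ne p ⊤ with rfl | hpt
    · simp [hθ]
    · have h1 : 1 ≤ p.toReal := by
        rw [← ENNReal.toReal_one]; exact ENNReal.toReal_mono hpt hp
      have : 1 / p.toReal ≤ 1 := by rw [div_le_one (by linarith)]; exact h1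
      linarith
  set A := eLpNorm f p (volume.restrict (unitBall d)) with hA
  have hAt : A ≠ ⊤ := hf.2.ne
  set v := volume (Metric.ball (0 : EuclideanSpace ℝ (Fin d)) 1) with hv
  have hvt : v ≠ ⊤ := measure_ball_lt_top.ne
  refine ⟨(A * v ^ θ).toReal, fun r hr => ?_⟩
  have hsub : Metric.ball (0 : EuclideanSpace ℝ (Fin d)) r ⊆ unitBall d :=
    Metric.ball_subset_ball hr.2.le
  have hfr : AEStronglyMeasurable f (volume.restrict (Metric.ball 0 r)) := hf.1.mono_set hsub
  have h1 : eLpNorm f 1 (volume.restrict (Metric.ball 0 r)) ≤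
      A * (ENNReal.ofReal (r ^ d) * v) ^ θ := by
    have h2 := eLpNorm_le_eLpNorm_mul_rpow_measure_univ hp hfr
    rw [Measure.restrict_apply_univ, Measure.addHaar_ball _ _ hr.1.le, finrank_euclideanSpace_fin,
      ENNReal.toReal_one, div_one] at h2
    refine h2.trans ?_
    gcongr
    exact eLpNorm_mono_measure _ (Measure.restrict_mono hsub le_rfl)
  have h3 : (A * (ENNReal.ofReal (r ^ d) * v) ^ θ).toReal =
      (A * v ^ θ).toReal * r ^ (d * θ) := by
    rw [ENNReal.mul_rpow_of_nonneg _ _ hθ0, ENNReal.toReal_mul, ENNReal.toReal_mul,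
      ENNReal.toReal_mul, ← ENNReal.toReal_rpow, ENNReal.toReal_ofReal (pow_nonneg hr.1.le _),
      ← Real.rpow_natCast, ← Real.rpow_mul hr.1.le]
    ring
  rw [← h3]
  have hfin : A * (ENNReal.ofReal (r ^ d) * v) ^ θ ≠ ⊤ :=
    ENNReal.mul_ne_top hAt (ENNReal.rpow_ne_top_of_nonneg hθ0
      (ENNReal.mul_ne_top ENNReal.ofReal_ne_top hvt))
  have h4 : |ballIntegral f r| ≤ (eLpNorm f 1 (volume.restrict (Metric.ball 0 r))).toReal := by
    rw [eLpNorm_one_eq_lintegral_enorm, ← integral_norm_eq_lintegral_enorm hfr]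
    exact norm_integral_le_integral_norm f
  exact h4.trans (ENNReal.toReal_mono hfin h1)

/-- Functions in `W^{2,p}` have a weak Laplacian in `L^p`. -/
theorem MemW2p.exists_weakLaplacian {U : Set (EuclideanSpace ℝ (Fin d))} {p : ℝ≥0∞}
    {u : EuclideanSpace ℝ (Fin d) → ℝ} (hu : MemW2p U p u) (hd : d ≠ 0) :
    ∃ f, MemLp f p (volume.restrict U) ∧ IsWeakLaplacian U u f := by
  obtain ⟨-, g, h, hg, hh⟩ := hu
  refine ⟨fun x => ∑ i, h i i x, memLp_finsetSum _ fun i _ => (hh i i).1, ?_, ?_, ?_⟩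
  · exact (hg ⟨0, Nat.pos_of_ne_zero hd⟩).2.1
  · have : ∀ s : Finset (Fin d), LocallyIntegrableOn (fun x => ∑ i ∈ s, h i i x) U := by
      intro s
      classical
      induction s using Finset.induction_on with
      | empty => simpa using (locallyIntegrable_const (0 : ℝ)).locallyIntegrableOn U
      | insert i s hi ih =>
        simp only [Finset.sum_insert hi]
        exact (hh i i).2.2.1.add ih
    exact this _
  · intro φ hφ
    have hloc : ∀ {w : EuclideanSpace ℝ (Fin d) → ℝ} {ψ : EuclideanSpace ℝ (Fin d) → ℝ},
        LocallyIntegrableOn w U → IsTestFunction U ψ → IntegrableOn (fun x => w x * ψ x) U := by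
      intro w ψ hw hψ
      have hi := hw.integrableOn_compact_subset hψ.2.2 hψ.2.1
      have h1 : IntegrableOn (fun x => w x * ψ x) (tsupport ψ) :=
        hi.mul_continuousOn hψ.1.continuous.continuousOn hψ.2.1
      refine ((integrableOn_iff_integrable_of_support_subset fun x hx => ?_).1 h1).integrableOn
      exact subset_tsupport _ fun h0 => hx (by simp [h0])
    have htest : ∀ i, IsTestFunction U fun y => fderiv ℝ φ y (EuclideanSpace.single i 1) := by
      intro i
      have hsup : Function.support (fun y => fderiv ℝ φ y (EuclideanSpace.single i 1)) ⊆
          tsupport φ := by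
        intro x hx
        refine support_fderiv_subset ℝ fun h0 => hx ?_
        simp [h0]
      refine ⟨(hφ.1.fderiv_right (m := ∞) (by simp)).clm_apply contDiff_const, ?_, ?_⟩
      · exact HasCompactSupport.of_support_subset_isCompact hφ.2.1 hsup
      · exact (closure_minimal hsup (isClosed_tsupport φ)).trans hφ.2.2
    have htest2 : ∀ i, IsTestFunction U fun x => fderiv ℝ
        (fun y => fderiv ℝ φ y (EuclideanSpace.single i 1)) x (EuclideanSpace.single i 1) := by
      intro i
      have hsup : Function.support (fun x => fderiv ℝ
        (fun y => fderiv ℝ φ y (EuclideanSpace.single i 1)) x (EuclideanSpace.single i 1)) ⊆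
          tsupport (fun y => fderiv ℝ φ y (EuclideanSpace.single i 1)) := by
        intro x hx
        refine support_fderiv_subset ℝ fun h0 => hx ?_
        simp [h0]
      refine ⟨((htest i).1.fderiv_right (m := ∞) (by simp)).clm_apply contDiff_const, ?_, ?_⟩
      · exact HasCompactSupport.of_support_subset_isCompact (htest i).2.1 hsup
      · exact (closure_minimal hsup (isClosed_tsupport _)).trans (htest i).2.2
    have hu0 := (hg ⟨0, Nat.pos_of_ne_zero hd⟩).2.1
    simp only [laplacian_eq_sum_fderiv hφ.1, Finset.mul_sum, Finset.sum_mul]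
    rw [integral_finsetSum _ fun i _ => hloc hu0 (htest2 i),
      integral_finsetSum _ fun i _ => hloc (hh i i).2.2.1 hφ]
    refine Finset.sum_congr rfl fun i _ => ?_
    rw [(hg i).2.2.2 _ (htest i), (hh i i).2.2.2 _ hφ, neg_neg]

/-! ### The logarithmic variable and the profile equation. -/

theorem _root_.AbsolutelyContinuousOnInterval.congr {f g : ℝ → ℝ} {a b : ℝ}
    (hf : AbsolutelyContinuousOnInterval f a b) (h : EqOn f g (uIcc a b)) :
    AbsolutelyContinuousOnInterval g a b := by
  rw [absolutelyContinuousOnInterval_iff] at hf ⊢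
  intro ε hε
  obtain ⟨δ, hδ, hd⟩ := hf ε hε
  refine ⟨δ, hδ, fun E hE hlt => ?_⟩
  refine lt_of_eq_of_lt (Finset.sum_congr rfl fun i hi => ?_) (hd E hE hlt)
  rw [h (hE.1 i hi).1, h (hE.1 i hi).2]

theorem tailIntegral_eq {J N : ℝ → ℝ} (hJ : ∀ t > 0, IntegrableOn J (Ioi t))
    (hN : ∀ t > 0, N t = ∫ r in Ioi t, J r) {a x : ℝ} (ha : 0 < a) (hx : a ≤ x) :
    N x = N a - ∫ r in a..x, J r := by
  rw [hN a ha, hN x (ha.trans_le hx),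
    ← intervalIntegral.integral_interval_add_Ioi (hJ a ha) (hJ x (ha.trans_le hx))]
  ring

theorem tailIntegral_intervalIntegrable {J : ℝ → ℝ}
    (hJ : ∀ t > 0, IntegrableOn J (Ioi t)) {a b : ℝ} (ha : 0 < a) (hab : a ≤ b) :
    IntervalIntegrable J volume a b := by
  rw [intervalIntegrable_iff_integrableOn_Ioc_of_le hab]
  exact (hJ a ha).mono_set Ioc_subset_Ioi_self

theorem tailIntegral_ac {J N : ℝ → ℝ} (hJ : ∀ t > 0, IntegrableOn J (Ioi t))
    (hN : ∀ t > 0, N t = ∫ r in Ioi t, J r) {a b : ℝ} (ha : 0 < a) (hab : a ≤ b) :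
    AbsolutelyContinuousOnInterval N a b := by
  have h1 := IntervalIntegrable.absolutelyContinuousOnInterval_intervalIntegral
    (tailIntegral_intervalIntegrable hJ ha hab) (c := a) (by simp)
  have h2 : AbsolutelyContinuousOnInterval (fun _ : ℝ => N a) a b :=
    absolutelyContinuousOnInterval_of_hasDerivAt (f' := fun _ => 0)
      (fun t _ => hasDerivAt_const t _) continuousOn_const ha hab
  refine (h2.sub h1).congr fun x hx => ?_
  rw [uIcc_of_le hab] at hx
  exact (tailIntegral_eq hJ hN ha hx.1).symm

theorem tailIntegral_ae_hasDerivAt {J N : ℝ → ℝ} (hJ : ∀ t > 0, IntegrableOn J (Ioi t))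
    (hN : ∀ t > 0, N t = ∫ r in Ioi t, J r) :
    ∀ᵐ t ∂(volume.restrict (Ioi (0 : ℝ))), HasDerivAt N (-J t) t := by
  have hpos : ∀ n : ℕ, (0 : ℝ) < 1 / ((n : ℝ) + 1) := fun n => by positivity
  have hle : ∀ n : ℕ, 1 / ((n : ℝ) + 1) ≤ (n : ℝ) + 1 := fun n => by
    have h1 : (1 : ℝ) ≤ (n : ℝ) + 1 := by linarith [(n.cast_nonneg : (0 : ℝ) ≤ n)]
    exact ((div_le_one (by linarith)).2 h1).trans h1
  -- Lebesgue differentiation on the intervals `[1/(n+1), n+1]`, which exhaust the half-line;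
  -- countably many null sets are discarded.
  have h := ae_all_iff.2 fun n : ℕ =>
    (tailIntegral_intervalIntegrable hJ (hpos n) (hle n)).ae_hasDerivAt_integral
  rw [ae_restrict_iff' measurableSet_Ioi]
  filter_upwards [h] with t ht ht0
  have ht0' : (0 : ℝ) < t := ht0
  obtain ⟨n, hn⟩ := exists_nat_gt (max t (1 / t))
  have hn1 : t < (n : ℝ) + 1 := ((le_max_left _ _).trans_lt hn).trans (lt_add_one _)
  have hn2 : 1 / ((n : ℝ) + 1) < t := by
    rw [div_lt_comm₀ (by positivity) ht0']
    exact ((le_max_right _ _).trans_lt hn).trans (lt_add_one _)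
  have h1 := ht n (by rw [uIcc_of_le (hle n)]; exact ⟨hn2.le, hn1.le⟩) (1 / ((n : ℝ) + 1)) (by simp)
  refine (h1.const_sub (N (1 / ((n : ℝ) + 1)))).congr_of_eventuallyEq ?_
  filter_upwards [Ioi_mem_nhds hn2] with x hx
  exact tailIntegral_eq hJ hN (hpos n) (le_of_lt hx)

theorem hasDerivAt_comp_exp_neg {U : ℝ → ℝ} {b t : ℝ} (h : HasDerivAt U b (Real.exp (-t))) :
    HasDerivAt (fun t => U (Real.exp (-t))) (b * -Real.exp (-t)) t := by
  refine HasDerivAt.comp t h ?_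
  simpa using (hasDerivAt_id t).neg.exp

theorem exp_neg_mem_Ioo {t : ℝ} (ht : 0 < t) : Real.exp (-t) ∈ Ioo (0 : ℝ) 1 :=
  ⟨Real.exp_pos _, Real.exp_lt_one_iff.2 (by linarith)⟩

theorem image_exp_neg_Ioi (t : ℝ) :
    (fun τ => Real.exp (-τ)) '' Ioi t = Ioo 0 (Real.exp (-t)) := by
  ext r
  constructor
  · rintro ⟨τ, hτ, rfl⟩
    exact ⟨Real.exp_pos _, Real.exp_lt_exp.2 (neg_lt_neg hτ)⟩
  · rintro ⟨h0, h1⟩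
    refine ⟨-Real.log r, ?_, by simp [Real.exp_log h0]⟩
    have := (Real.log_lt_iff_lt_exp h0).2 h1
    exact mem_Ioi.2 (by linarith)

theorem change_variable_exp_neg (g : ℝ → ℝ) (t : ℝ) :
    (IntegrableOn g (Ioo 0 (Real.exp (-t))) ↔
      IntegrableOn (fun τ => Real.exp (-τ) * g (Real.exp (-τ))) (Ioi t)) ∧
    ∫ r in Ioo 0 (Real.exp (-t)), g r = ∫ τ in Ioi t, Real.exp (-τ) * g (Real.exp (-τ)) := by
  have hd : ∀ x ∈ Ioi t, HasDerivWithinAt (fun τ => Real.exp (-τ)) (-Real.exp (-x)) (Ioi t) x :=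
    fun x _ => by simpa using ((hasDerivAt_id x).neg.exp).hasDerivWithinAt
  have hi : InjOn (fun τ => Real.exp (-τ)) (Ioi t) := fun x _ y _ h => by
    simpa using Real.exp_injective h
  have h1 := integrableOn_image_iff_integrableOn_abs_deriv_smul measurableSet_Ioi hd hi g
  have h2 := integral_image_eq_integral_abs_deriv_smul measurableSet_Ioi hd hi g
  simp only [abs_neg, Real.abs_exp, smul_eq_mul] at h1 h2
  rw [image_exp_neg_Ioi] at h1 h2
  exact ⟨h1, h2⟩

theorem ballIntegral_radial [Nontrivial (EuclideanSpace ℝ (Fin d))]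
    {f : EuclideanSpace ℝ (Fin d) → ℝ} {g : ℝ → ℝ} {r : ℝ} (hr : r < 1)
    (hf : LocallyIntegrableOn f (unitBall d))
    (hfg : ∀ᵐ x ∂(volume.restrict (unitBall d)), f x = g ‖x‖) :
    IntegrableOn (fun s => s ^ (d - 1) * g s) (Ioo 0 r) ∧
      ballIntegral f r = sphereArea d * ∫ s in Ioo 0 r, s ^ (d - 1) * g s := by
  have hsub : Metric.ball (0 : EuclideanSpace ℝ (Fin d)) r ⊆ unitBall d :=
    Metric.ball_subset_ball hr.le
  have hae : f =ᵐ[volume.restrict (Metric.ball 0 r)] fun x => g ‖x‖ :=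
    ae_restrict_of_ae_restrict_of_subset hsub hfg
  have hi : IntegrableOn f (Metric.ball 0 r) :=
    (hf.integrableOn_compact_subset (Metric.closedBall_subset_ball hr)
      (isCompact_closedBall 0 r)).mono_set Metric.ball_subset_closedBall
  constructor
  · have h1 : IntegrableOn (fun x : EuclideanSpace ℝ (Fin d) => g ‖x‖) (Metric.ball 0 r) :=
      hi.congr hae
    have h2 := (integrableOn_fun_norm_addHaar volume).1 h1
    simpa only [finrank_euclideanSpace_fin, smul_eq_mul] using h2
  · have h1 : ballIntegral f r =
        ∫ x : EuclideanSpace ℝ (Fin d), (Iio r).indicator g ‖x‖ := by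
      unfold ballIntegral
      rw [integral_congr_ae hae, ← integral_indicator measurableSet_ball]
      refine integral_congr_ae (Eventually.of_forall fun x => ?_)
      simp [indicator]
    rw [h1, integral_fun_norm_eq]
    congr 1
    rw [← integral_indicator measurableSet_Ioi, ← integral_indicator measurableSet_Ioo]
    refine integral_congr_ae (Eventually.of_forall fun s => ?_)
    by_cases h0 : 0 < s <;> by_cases h2 : s < r <;> simp [h0, h2]

theorem one_le_of_half_lt (hd : 2 ≤ d) {p : ℝ≥0∞} (hp : (d : ℝ≥0∞) / 2 < p) : 1 ≤ p := by
  refine le_trans ?_ hp.le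
  rw [ENNReal.le_div_iff_mul_le (by simp) (by simp), one_mul]
  exact_mod_cast hd

/-- The exponent is `2 - d/p`, read as `2` when `p = ⊤`. This is where `p > d/2` is decisive. -/
theorem decay_exponent_pos {p : ℝ≥0∞} (hp : (d : ℝ≥0∞) / 2 < p) :
    0 < 2 - d + d * (1 - 1 / p.toReal) := by
  rcases eq_or_ne p ⊤ with rfl | hpt
  · simp
  · have h1 := ENNReal.toReal_strict_mono hpt hp
    simp only [ENNReal.toReal_div, ENNReal.toReal_natCast, ENNReal.toReal_ofNat] at h1
    have h0 : 0 < p.toReal := lt_of_le_of_lt (by positivity) h1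
    have h2 : (d : ℝ) / p.toReal < 2 := by
      rw [div_lt_iff₀ h0]; linarith
    have h3 : 2 - (d : ℝ) + d * (1 - 1 / p.toReal) = 2 - d / p.toReal := by ring
    linarith

/-- The profile of `√γ` in the logarithmic variable. -/
theorem exists_profile (hd : 2 ≤ d) {p : ℝ≥0∞} (hp : (d : ℝ≥0∞) / 2 < p)
    {γ : EuclideanSpace ℝ (Fin d) → ℝ} (hcond : IsConductivity γ) (hrad : IsRadial γ)
    (hγ : MemW2p (unitBall d) p γ) {V : EuclideanSpace ℝ (Fin d) → ℝ} (hV : IsPotentialOf γ V)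
    {q : ℝ → ℝ} (hq : IsRadialProfile V q) :
    ∃ W W₁ : ℝ → ℝ, IsDecayingProfile W W₁ ∧
      SolvesProfileEq (halfLinePotential q) W W₁ (nu d) := by
  have hd0 : d ≠ 0 := by lia
  have hfin : Module.finrank ℝ (EuclideanSpace ℝ (Fin d)) = d := finrank_euclideanSpace_fin
  have : Nontrivial (EuclideanSpace ℝ (Fin d)) :=
    Module.nontrivial_of_finrank_pos (R := ℝ) (by rw [hfin]; lia)
  have hσ := sphereArea_pos hd0
  obtain ⟨hγc, c, hc, hγl⟩ := hcond
  obtain ⟨M, hM⟩ := (isCompact_closedBall (0 : EuclideanSpace ℝ (Fin d)) 1).exists_bound_of_continuousOn hγc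
  set e₀ : EuclideanSpace ℝ (Fin d) := EuclideanSpace.single ⟨0, by lia⟩ 1 with he₀
  have he₀n : ‖e₀‖ = 1 := by simp [he₀]
  have hnorm : ∀ r : ℝ, 0 ≤ r → ‖r • e₀‖ = r := fun r hr => by
    rw [norm_smul, he₀n, mul_one, Real.norm_of_nonneg hr]
  set Γ : ℝ → ℝ := fun r => γ (r • e₀) with hΓ
  set U : ℝ → ℝ := fun r => √(Γ r) with hU
  have hmem : ∀ r ∈ Ioo (0 : ℝ) 1, r • e₀ ∈ unitBall d := fun r hr => by
    rw [mem_ball_zero_iff, hnorm r hr.1.le]; exact hr.2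
  have hΓx : ∀ x ∈ unitBall d, γ x = Γ ‖x‖ := by
    intro x hx
    have hx1 : ‖x‖ < 1 := mem_ball_zero_iff.1 hx
    refine hrad x hx _ ?_ (hnorm _ (norm_nonneg x)).symm
    rw [mem_ball_zero_iff, hnorm _ (norm_nonneg x)]
    exact hx1
  have hUx : ∀ x ∈ unitBall d, √(γ x) = U ‖x‖ := fun x hx => by rw [hΓx x hx]
  have hΓc : ContinuousOn Γ (Ioo 0 1) :=
    hγc.comp (by fun_prop) fun r hr => Metric.ball_subset_closedBall (hmem r hr)
  have hUc : ContinuousOn U (Ioo 0 1) := hΓc.sqrt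
  have hΓl : ∀ r ∈ Ioo (0 : ℝ) 1, c ≤ Γ r := fun r hr => hγl _ (hmem r hr)
  obtain ⟨fγ, hfγ, hwγ⟩ := hγ.exists_weakLaplacian hd0
  have hdΓ := hwγ.hasDerivAt_radial hd0 hΓx hΓc
  have hdU := IsWeakLaplacian.hasDerivAt_radial hd0 hUx hUc hV
  set f : EuclideanSpace ℝ (Fin d) → ℝ := fun x => V x * √(γ x) with hf
  obtain ⟨C, hC⟩ := ballIntegral_le_of_memLp (one_le_of_half_lt hd hp) hfγ
  set W : ℝ → ℝ := fun t => U (Real.exp (-t)) with hW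
  set W₁ : ℝ → ℝ := fun t => ((Real.exp (-t) ^ (d - 1))⁻¹ * ballIntegral f (Real.exp (-t)) /
    sphereArea d) * -Real.exp (-t) with hW₁
  have hWd : ∀ t > 0, HasDerivAt W (W₁ t) t := fun t ht =>
    hasDerivAt_comp_exp_neg (hdU _ (exp_neg_mem_Ioo ht))
  have hWl : ∀ t > 0, √c ≤ W t := fun t ht => Real.sqrt_le_sqrt (hΓl _ (exp_neg_mem_Ioo ht))
  have hsc : 0 < √c := Real.sqrt_pos.2 hc
  have hexpc : Continuous fun t : ℝ => Real.exp (-t) := by fun_prop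
  have hdpow : ∀ t : ℝ, Real.exp (-t) ^ (d - 1) = Real.exp (-(((d : ℝ) - 1) * t)) := by
    intro t
    rw [← Real.exp_nat_mul, Nat.cast_sub (by lia)]
    congr 1
    push_cast
    ring
  refine ⟨W, W₁, ⟨⟨√c, hsc, hWl⟩, ⟨√M, fun t ht => ?_⟩, hWd, ?_, ?_⟩, ?_⟩
  · refine Real.sqrt_le_sqrt ((le_abs_self _).trans ?_)
    exact hM _ (Metric.ball_subset_closedBall (hmem _ (exp_neg_mem_Ioo ht)))
  · refine ContinuousOn.mul (ContinuousOn.div_const (ContinuousOn.mul ?_ ?_) _) hexpc.neg.continuousOn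
    · exact (ContinuousOn.inv₀ (by fun_prop) fun t _ => (pow_pos (Real.exp_pos _) _).ne')
    · exact (continuousOn_ballIntegral hV.2.1).comp hexpc.continuousOn
        fun t ht => exp_neg_mem_Ioo ht
  -- The decay comes from `γ`, not `√γ`: `Δγ` is in `L^p` on the whole ball, while `V√γ` is only
  -- known to be locally integrable. Since `W² = Γ(e^{-t})`, one has `2WW₁ = -rΓ'(r)` at `r =
  -- e^{-t}`, of size `r · r^{-(d-1)} · r^{d(1-1/p)} = r^δ`.
  · set δ : ℝ := 2 - d + d * (1 - 1 / p.toReal) with hδ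
    refine ⟨δ, decay_exponent_pos hp, C / sphereArea d / (2 * √c), fun t ht => ?_⟩
    have hr := exp_neg_mem_Ioo ht
    have h1 := hasDerivAt_comp_exp_neg (hdΓ _ hr)
    have h2 : HasDerivAt (fun t => Γ (Real.exp (-t))) (2 * W t * W₁ t) t := by
      have h3 := (hWd t ht).pow 2
      refine (h3.congr_deriv (by simp)).congr_of_eventuallyEq ?_
      filter_upwards [Ioi_mem_nhds ht] with s hs
      simp only [hW, hU, Pi.pow_apply]
      rw [Real.sq_sqrt (hc.le.trans (hΓl _ (exp_neg_mem_Ioo hs)))]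
    have h4 := h2.unique h1
    have h5 := hC _ hr
    have hWp : 0 < W t := hsc.trans_le (hWl t ht)
    have h6 : |2 * W t * W₁ t| ≤ C / sphereArea d * Real.exp (-δ * t) := by
      rw [h4, abs_mul, abs_neg, Real.abs_exp, abs_div, abs_mul, abs_inv, abs_pow, Real.abs_exp,
        abs_of_pos hσ]
      have h7 : (Real.exp (-t) ^ (d - 1))⁻¹ * Real.exp (-t) ^ ((d : ℝ) * (1 - 1 / p.toReal)) *
          Real.exp (-t) = Real.exp (-δ * t) := by
        rw [hdpow, ← Real.exp_neg, ← Real.exp_mul, ← Real.exp_add, ← Real.exp_add]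
        congr 1
        rw [hδ]
        ring
      calc (Real.exp (-t) ^ (d - 1))⁻¹ * |ballIntegral fγ (Real.exp (-t))| / sphereArea d *
            Real.exp (-t) ≤ (Real.exp (-t) ^ (d - 1))⁻¹ *
            (C * Real.exp (-t) ^ ((d : ℝ) * (1 - 1 / p.toReal))) / sphereArea d *
            Real.exp (-t) := by gcongr
        _ = C / sphereArea d * ((Real.exp (-t) ^ (d - 1))⁻¹ *
            Real.exp (-t) ^ ((d : ℝ) * (1 - 1 / p.toReal)) * Real.exp (-t)) := by ring
        _ = _ := by rw [h7]
    rw [abs_mul, abs_of_pos (by positivity : 0 < 2 * W t)] at h6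
    have h8 : 2 * √c * |W₁ t| ≤ 2 * W t * |W₁ t| := by gcongr; exact hWl t ht
    rw [div_mul_eq_mul_div, le_div_iff₀ (by positivity)]
    linarith
  · have hfg : ∀ᵐ x ∂(volume.restrict (unitBall d)), f x = q ‖x‖ * U ‖x‖ := by
      filter_upwards [hq, ae_restrict_mem measurableSet_ball] with x hx hm
      simp only [hf]
      rw [hx, hUx x hm]
    set g : ℝ → ℝ := fun s => s ^ (d - 1) * (q s * U s) with hg
    set J : ℝ → ℝ := fun τ => Real.exp (-τ) * g (Real.exp (-τ)) with hJdef
    have hbi := fun t (ht : t > 0) => ballIntegral_radial (g := fun s => q s * U s)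
      (exp_neg_mem_Ioo ht).2 hV.2.1 hfg
    have hJ : ∀ t > 0, IntegrableOn J (Ioi t) := fun t ht =>
      (change_variable_exp_neg g t).1.1 (hbi t ht).1
    set N : ℝ → ℝ := fun t => ballIntegral f (Real.exp (-t)) / sphereArea d with hNdef
    have hN : ∀ t > 0, N t = ∫ r in Ioi t, J r := by
      intro t ht
      simp only [hNdef]
      rw [(hbi t ht).2, mul_div_cancel_left₀ _ hσ.ne']
      exact (change_variable_exp_neg g t).2
    have hE : ∀ t, HasDerivAt (fun t => -Real.exp (2 * nu d * t))
        (-(Real.exp (2 * nu d * t) * (2 * nu d))) t := fun t => by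
      simpa using (((hasDerivAt_id t).const_mul (2 * nu d)).exp).fun_neg
    -- This exhibits `W₁` as a smooth factor times a tail integral, hence locally absolutely
    -- continuous. Differentiating the exponential gives `2νW₁`, and differentiating the tail gives
    -- `e^{2νt} J = QW`.
    have hW₁N : W₁ = fun t => -Real.exp (2 * nu d * t) * N t := by
      ext t
      simp only [hW₁, hNdef]
      rw [hdpow, ← Real.exp_neg]
      have h1 : Real.exp (2 * nu d * t) = Real.exp (- -(((d : ℝ) - 1) * t)) * Real.exp (-t) := by
        rw [← Real.exp_add]
        congr 1
        unfold nu
        ring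
      rw [h1]
      ring
    refine ⟨fun a b ha hab => ?_, ?_⟩
    · rw [hW₁N]
      exact (absolutelyContinuousOnInterval_of_hasDerivAt (fun t _ => hE t) (by fun_prop) ha
        hab).mul (tailIntegral_ac hJ hN ha hab)
    · filter_upwards [tailIntegral_ae_hasDerivAt hJ hN] with t ht
      rw [hW₁N]
      refine ((hE t).mul ht).congr_deriv ?_
      have h1 : Real.exp (2 * nu d * t) * J t = halfLinePotential q t * W t := by
        simp only [hJdef, hg, hW, halfLinePotential, hdpow]
        have h2 : Real.exp (2 * nu d * t) * (Real.exp (-t) * Real.exp (-(((d : ℝ) - 1) * t))) =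
            Real.exp (-2 * t) := by
          rw [← Real.exp_add, ← Real.exp_add]
          congr 1
          unfold nu
          ring
        rw [← h2]
        ring
      linear_combination h1

end RadialDtN

/-! ### The spectral conclusions. -/

theorem lemma3p5 (d : ℕ) (hd : 2 ≤ d) (p : ℝ≥0∞) (hp : (d : ℝ≥0∞) / 2 < p)
    (γ : EuclideanSpace ℝ (Fin d) → ℝ)
    (hcond : IsConductivity γ) (hrad : IsRadial γ) (hγ : MemW2p (unitBall d) p γ)
    (V : EuclideanSpace ℝ (Fin d) → ℝ) (hV : IsPotentialOf γ V)
    (q : ℝ → ℝ) (hq : IsRadialProfile V q) :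
    (2 < d →
      opPointSpectrum (schrodingerOp (halfLinePotential q)) ⊆
        (fun x : ℝ => (x : ℂ)) '' Ioo (-(nu d) ^ 2) 0 ∧
      opDiscreteSpectrum (schrodingerOp (halfLinePotential q)) ⊆
        (fun x : ℝ => (x : ℂ)) '' Ioo (-(nu d) ^ 2) 0) ∧
    (d = 2 →
      opPointSpectrum (schrodingerOp (halfLinePotential q)) = ∅ ∧
      opDiscreteSpectrum (schrodingerOp (halfLinePotential q)) = ∅ ∧
      ¬ HasZeroResonance (halfLinePotential q)) := by
  obtain ⟨W, W₁, hW, hWQ⟩ := exists_profile hd hp hcond hrad hγ hV hq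
  have hν : 0 ≤ nu d := by
    have : (2 : ℝ) ≤ d := by exact_mod_cast hd
    unfold nu
    linarith
  have hpoint : opPointSpectrum (schrodingerOp (halfLinePotential q)) ⊆
      (fun x : ℝ => (x : ℂ)) '' Ioo (-(nu d) ^ 2) 0 := by
    intro z hz
    obtain ⟨v, v₁, w, hv, h0, he, hint, hne⟩ := exists_solution_of_mem_pointSpectrum hz
    exact (hW.eq_zero_or_mem_Ioo hWQ hν hv h0 he hint).resolve_left hne
  have hdisc := opDiscreteSpectrum_subset_pointSpectrum (schrodingerOp (halfLinePotential q))
  refine ⟨fun _ => ⟨hpoint, hdisc.trans hpoint⟩, ?_⟩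
  rintro rfl
  have hν0 : nu 2 = 0 := by simp [nu]
  have hempty : opPointSpectrum (schrodingerOp (halfLinePotential q)) = ∅ := by
    rw [hν0] at hpoint
    simpa using hpoint
  rw [hν0] at hWQ
  exact ⟨hempty, subset_empty_iff.1 (hempty ▸ hdisc), hW.not_hasZeroResonance hWQ⟩
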